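/- Let $d, m \in \mathbb{N}$, $1 < p < d$, $r > 0$ and $p^* := \frac{pd}{d-p}$. For $\varepsilon > 0$ and $u \in L^p(\mathbb{R}^d;\mathbb{R}^m)$ set $$G_\varepsilon^{r,p}(u,\mathbb{R}^d) := \int_{B_r}\int_{\mathbb{R}^d}\left|\frac{u(x+\varepsilon\xi)-u(x)}{\varepsilon}\right|^p dx\,d\xi ,$$ where $B_r$ is the open ball of radius $r$ centred at the origin of $\mathbb{R}^d$. Let $\{u_\varepsilon\}_{\varepsilon>0} \subset L^p(\mathbb{R}^d;\mathbb{R}^m)$ be such that (i) $\sup_{\varepsilon>0}\|u_\varepsilon\|_{L^p(K;\mathbb{R}^m)} < +\infty$ for every compact set $K \subset \mathbb{R}^d$; (ii) $\sup_{\varepsilon>0} G_\varepsilon^{r,p}(u_\varepsilon,\mathbb{R}^d) < +\infty$. Then, for every sequence of positive numbers $\varepsilon_j \to 0$, the set $\{u_{\varepsilon_j}\}_j$ is relatively compact in $L^p_{\rm loc}(\mathbb{R}^d;\mathbb{R}^m)$ (with the topology of strong convergence in $L^p(K;\mathbb{R}^m)$ for every compact $K$), and the limit in $L^p_{\rm loc}(\mathbb{R}^d;\mathbb{R}^m)$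 of every converging subsequence of $\{u_{\varepsilon_j}\}_j$ lies in $W^{1,p}_{\rm loc}(\mathbb{R}^d;\mathbb{R}^m)\cap L^{p^*}(\mathbb{R}^d;\mathbb{R}^m)$. -/

import Mathlib

open MeasureTheory Filter Topology
open scoped ENNReal NNReal ContDiff

/-- Local integrability to the power `p`: `f ∈ L^p(K)` for every compact `K`. -/
def MemLpLoc {d m : ℕ} (f : EuclideanSpace ℝ (Fin d) → EuclideanSpace ℝ (Fin m))
    (p : ℝ≥0∞) : Prop :=
  ∀ K : Set (EuclideanSpace ℝ (Fin d)), IsCompact K → MemLp f p (volume.restrict K)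

/-- The space `L^p_loc(ℝ^d; ℝ^m)`, functions being identified when they agree almost everywhere. -/
def LpLoc (d m : ℕ) (p : ℝ≥0∞) : Type :=
  {f : EuclideanSpace ℝ (Fin d) →ₘ[volume] EuclideanSpace ℝ (Fin m) // MemLpLoc f p}

/-- The restriction map `L^p_loc(ℝ^d; ℝ^m) → L^p(K; ℝ^m)` for `K` compact. -/
noncomputable def LpLoc.restrict {d m : ℕ} {p : ℝ≥0∞}
    (K : TopologicalSpace.Compacts (EuclideanSpace ℝ (Fin d))) (f : LpLoc d m p) :
    Lp (EuclideanSpace ℝ (Fin m)) p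
      (volume.restrict (K : Set (EuclideanSpace ℝ (Fin d)))) :=
  (f.2 K K.isCompact).toLp f.1

/-- The usual topology of `L^p_loc`: strong convergence in `L^p(K)` for every compact `K`, i.e.
the coarsest topology making all the restriction maps `L^p_loc → L^p(K)` continuous. -/
noncomputable instance LpLoc.instTopologicalSpace {d m : ℕ} {p : ℝ≥0∞} [Fact (1 ≤ p)] :
    TopologicalSpace (LpLoc d m p) :=
  ⨅ K : TopologicalSpace.Compacts (EuclideanSpace ℝ (Fin d)),
    TopologicalSpace.induced (LpLoc.restrict K) inferInstance

/-- The inclusion `L^p(ℝ^d; ℝ^m) ⊆ L^p_loc(ℝ^d; ℝ^m)`. -/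
def LpLoc.ofLp {d m : ℕ} {p : ℝ≥0∞}
    (f : Lp (EuclideanSpace ℝ (Fin m)) p (volume : Measure (EuclideanSpace ℝ (Fin d)))) :
    LpLoc d m p :=
  ⟨f.1, fun K _ => (Lp.memLp f).restrict K⟩

/-- `g` is the `i`-th weak partial derivative of `v` on `ℝ^d`:
`∫ (∂ᵢφ) v = - ∫ φ g` for every `φ ∈ C_c^∞(ℝ^d)`. -/
def HasWeakPartialDeriv {d m : ℕ} (i : Fin d)
    (v g : EuclideanSpace ℝ (Fin d) → EuclideanSpace ℝ (Fin m)) : Prop :=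
  ∀ φ : EuclideanSpace ℝ (Fin d) → ℝ, ContDiff ℝ ∞ φ → HasCompactSupport φ →
    ∫ x, (fderiv ℝ φ x (EuclideanSpace.single i 1)) • v x = - ∫ x, φ x • g x

/-- The local Sobolev space `W^{1,p}_loc(ℝ^d; ℝ^m)`. -/
def MemW1pLoc {d m : ℕ} (v : EuclideanSpace ℝ (Fin d) → EuclideanSpace ℝ (Fin m))
    (p : ℝ≥0∞) : Prop :=
  MemLpLoc v p ∧
    ∀ i : Fin d, ∃ g : EuclideanSpace ℝ (Fin d) → EuclideanSpace ℝ (Fin m),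
      MemLpLoc g p ∧ HasWeakPartialDeriv i v g

/-- The difference quotient `D_ε^ξ u(x) = (u(x + εξ) - u(x)) / ε`. -/
noncomputable def diffQuot {d m : ℕ} (ε : ℝ) (ξ : EuclideanSpace ℝ (Fin d))
    (u : EuclideanSpace ℝ (Fin d) → EuclideanSpace ℝ (Fin m))
    (x : EuclideanSpace ℝ (Fin d)) : EuclideanSpace ℝ (Fin m) :=
  ε⁻¹ • (u (x + ε • ξ) - u x)

/-- The set `A_ε(ξ) = {x ∈ A : x + εξ ∈ A}`. -/
def shiftSet {d : ℕ} (A : Set (EuclideanSpace ℝ (Fin d))) (ε : ℝ)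
    (ξ : EuclideanSpace ℝ (Fin d)) : Set (EuclideanSpace ℝ (Fin d)) :=
  {x | x ∈ A ∧ x + ε • ξ ∈ A}

/-- The convolution-type energy
`G_ε^{r,p}(u, A) = ∫_{B_r} ∫_{A_ε(ξ)} |D_ε^ξ u(x)|^p dx dξ`, with values in `[0, ∞]`. -/
noncomputable def convEnergy {d m : ℕ} (r p ε : ℝ)
    (u : EuclideanSpace ℝ (Fin d) → EuclideanSpace ℝ (Fin m))
    (A : Set (EuclideanSpace ℝ (Fin d))) : ℝ≥0∞ :=
  ∫⁻ ξ in Metric.ball (0 : EuclideanSpace ℝ (Fin d)) r,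
    ∫⁻ x in shiftSet A ε ξ, ‖diffQuot ε ξ u x‖ₑ ^ p

/-! Mollify `u` at scale `s` with a kernel `ρ` of integral one, supported in `B_r`: put `w(x) = ∫
ρ(ξ) u(x + sξ) dξ`. Since `∫ ρ = 1` and `∫ ∂ρ = 0`, the value `u(x)` can be subtracted under both
integrals, so that `w - u = s ∫ ρ(ξ) D_s^ξ u dξ` and `∂w = -∫ ∂ρ(ξ) D_s^ξ u dξ`. Both are controlled
pointwise by the mean difference quotient `diffQuotInt`, whose `L^p` norm is bounded by the energy
at scale `s` (`lintegral_diffQuotInt_rpow_le`). Hence `‖w - u‖_p = O(s)` and `‖∇w‖_p = O(1)`.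

Compactness: telescoping shows that the energy does not increase when `ε` is replaced by `nε`
(`convEnergy_nat_mul_le`), so for small `ε` one may mollify at a scale comparable to a fixed `η`. On
a compact `K` the mollified functions are then equibounded and equi-Lipschitz, hence totally bounded
in `L^p(K)` by Arzelà–Ascoli, and they are `O(η)`-close to the original ones. Tychonoff's theorem
passes from all `L^p(K)` to `L^p_loc`, which is a closed subspace of their product.

Limits: mollifying at scale `ε_j` itself gives `C^1` functions with the same `L^p_loc` limit `v` and
with gradients bounded in `L^p`. A point common to the closed convex hulls of the tails of the
gradients, which exists by uniform convexity of `L^p`, plays the role of a weak limit and is the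
weak gradient of `v`. The Gagliardo–Nirenberg–Sobolev inequality and Fatou's lemma put `v` in
`L^{p^*}`. -/

section UniformConvexity

/-! ### Uniform convexity of `L^p` and a substitute for weak compactness. -/

theorem add_rpow_le_two_rpow_mul {a b p : ℝ} (ha : 0 ≤ a) (hb : 0 ≤ b) (hp : 1 ≤ p) :
    (a + b) ^ p ≤ 2 ^ (p - 1) * (a ^ p + b ^ p) := by
  lift a to NNReal using ha
  lift b to NNReal using hb
  exact_mod_cast NNReal.rpow_add_le_mul_rpow_add_rpow a b hp

theorem norm_add_rpow_le {F : Type*} [SeminormedAddCommGroup F] {p : ℝ} (hp : 1 ≤ p) (a b : F) :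
    ‖a + b‖ ^ p ≤ 2 ^ (p - 1) * (‖a‖ ^ p + ‖b‖ ^ p) :=
  (Real.rpow_le_rpow (norm_nonneg _) (norm_add_le a b) (by linarith)).trans
    (add_rpow_le_two_rpow_mul (norm_nonneg a) (norm_nonneg b) hp)

/-- If the norms agree, strict convexity of the space makes the triangle inequality strict; if they
differ, strict convexity of `t ↦ t ^ p` does the work. -/
theorem norm_add_rpow_lt {F : Type*} [NormedAddCommGroup F] [NormedSpace ℝ F]
    [StrictConvexSpace ℝ F] {p : ℝ} (hp : 1 < p) {a b : F} (hab : a ≠ b) :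
    ‖a + b‖ ^ p < 2 ^ (p - 1) * (‖a‖ ^ p + ‖b‖ ^ p) := by
  have hp0 : 0 < p := by linarith
  by_cases hn : ‖a‖ = ‖b‖
  · have h1 : ‖a + b‖ < ‖a‖ + ‖b‖ := by
      refine lt_of_le_of_ne (norm_add_le a b) fun h => hab ?_
      exact (sameRay_iff_norm_add.2 h).eq_of_norm_eq hn
    refine (Real.rpow_lt_rpow (norm_nonneg _) h1 hp0).trans_le ?_
    exact add_rpow_le_two_rpow_mul (norm_nonneg a) (norm_nonneg b) hp.le
  · refine (Real.rpow_le_rpow (norm_nonneg _) (norm_add_le a b) hp0.le).trans_lt ?_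
    have h := (strictConvexOn_rpow hp).2 (norm_nonneg a) (norm_nonneg b) hn
      (half_pos one_pos) (half_pos one_pos) (by norm_num)
    simp only [smul_eq_mul] at h
    have e : ‖a‖ + ‖b‖ = 2 * (1 / 2 * ‖a‖ + 1 / 2 * ‖b‖) := by ring
    rw [e, Real.mul_rpow (by norm_num) (by positivity), Real.rpow_sub_one (by norm_num)]
    have h2 : (0 : ℝ) < 2 ^ p := by positivity
    calc _ < (2 : ℝ) ^ p * (1 / 2 * ‖a‖ ^ p + 1 / 2 * ‖b‖ ^ p) := by gcongr
      _ = _ := by ring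

/-- A quantitative form of the strict convexity of `‖·‖ ^ p` on a proper strictly convex space. -/
theorem exists_norm_add_rpow_add_le {F : Type*} [NormedAddCommGroup F] [NormedSpace ℝ F]
    [StrictConvexSpace ℝ F] [ProperSpace F] {p : ℝ} (hp : 1 < p) {δ : ℝ} (hδ : 0 < δ) :
    ∃ c : ℝ, 0 < c ∧ ∀ a b : F, ‖a + b‖ ^ p + c * (‖a - b‖ ^ p - δ * (‖a‖ ^ p + ‖b‖ ^ p)) ≤
      2 ^ (p - 1) * (‖a‖ ^ p + ‖b‖ ^ p) := by
  have hp0 : 0 < p := by linarith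
  have hcont : ∀ {f : F × F → F}, Continuous f → Continuous fun z => ‖f z‖ ^ p := fun hf =>
    hf.norm.rpow_const fun _ => Or.inr hp0.le
  set S : F × F → ℝ := fun z => ‖z.1‖ ^ p + ‖z.2‖ ^ p with hS
  have hSc : Continuous S := (hcont continuous_fst).add (hcont continuous_snd)
  -- `K` is the part of the unit sphere where the bracket in the claim is nonnegative. It avoids the
  -- diagonal, so the convexity deficit has a positive minimum on it.
  set K : Set (F × F) := Metric.sphere 0 1 ∩ {z | δ * S z ≤ ‖z.1 - z.2‖ ^ p} with hK
  have hKc : IsCompact K := (isCompact_sphere 0 1).inter_right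
    (isClosed_le (continuous_const.mul hSc) (hcont (continuous_fst.sub continuous_snd)))
  have key : ∃ c : ℝ, 0 < c ∧ ∀ z ∈ K, ‖z.1 + z.2‖ ^ p + c * S z ≤ 2 ^ (p - 1) * S z := by
    rcases K.eq_empty_or_nonempty with h | h
    · exact ⟨1, one_pos, by simp [h]⟩
    obtain ⟨z₀, hz₀, hmin⟩ := hKc.exists_isMinOn h
      (f := fun z => 2 ^ (p - 1) * S z - ‖z.1 + z.2‖ ^ p)
      ((continuous_const.mul hSc).sub (hcont (continuous_fst.add continuous_snd))).continuousOn
    have hpos : 0 < 2 ^ (p - 1) * S z₀ - ‖z₀.1 + z₀.2‖ ^ p := by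
      refine sub_pos.2 (norm_add_rpow_lt hp fun h => ?_)
      have h1 : ‖z₀‖ = 1 := by simpa using hz₀.1
      have h2 : δ * S z₀ ≤ 0 := by
        have := hz₀.2
        simpa [h, Real.zero_rpow hp0.ne'] using this
      have h3 : S z₀ ≤ 0 := by nlinarith
      have h4 : 0 ≤ ‖z₀.2‖ ^ p := by positivity
      have h5 : ‖z₀.2‖ ^ p = 0 := by
        simp only [hS, h] at h3
        linarith
      have h6 : z₀.2 = 0 := by
        rwa [Real.rpow_eq_zero (norm_nonneg _) hp0.ne', norm_eq_zero] at h5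
      have h7 : z₀ = 0 := Prod.ext (h.trans h6) h6
      simp [h7] at h1
    -- Half the minimal deficit suffices because `S ≤ 2` on the unit sphere of the sup norm.
    refine ⟨_, half_pos hpos, fun z hz => ?_⟩
    have h1 : ‖z‖ = 1 := by simpa using hz.1
    have h2 : S z ≤ 2 := by
      have ha : ‖z.1‖ ^ p ≤ 1 := Real.rpow_le_one (norm_nonneg _) (h1 ▸ norm_fst_le z) hp0.le
      have hb : ‖z.2‖ ^ p ≤ 1 := Real.rpow_le_one (norm_nonneg _) (h1 ▸ norm_snd_le z) hp0.le
      simp only [hS]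
      linarith
    have h3 := hmin hz
    simp only [Set.mem_ofPred_eq] at h3
    nlinarith
  obtain ⟨c, hc, hcK⟩ := key
  have hom : ∀ a b : F, δ * S (a, b) ≤ ‖a - b‖ ^ p →
      ‖a + b‖ ^ p + c * S (a, b) ≤ 2 ^ (p - 1) * S (a, b) := by
    intro a b hab
    by_cases h0 : (a, b) = (0 : F × F)
    · obtain ⟨rfl, rfl⟩ := Prod.mk_eq_zero.1 h0
      simp [hS, Real.zero_rpow hp0.ne']
    have ht : 0 < ‖(a, b)‖ := norm_pos_iff.2 h0
    set t := ‖(a, b)‖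
    have hsm : ∀ v : F, ‖t⁻¹ • v‖ ^ p = (t⁻¹) ^ p * ‖v‖ ^ p := fun v => by
      rw [norm_smul, Real.norm_of_nonneg (by positivity),
        Real.mul_rpow (by positivity) (norm_nonneg _)]
    have hSs : S (t⁻¹ • a, t⁻¹ • b) = (t⁻¹) ^ p * S (a, b) := by
      simp only [hS, hsm]
      ring
    have htp : 0 < (t⁻¹) ^ p := by positivity
    have h := hcK (t⁻¹ • a, t⁻¹ • b) ⟨by
      rw [mem_sphere_zero_iff_norm, ← Prod.smul_mk, norm_smul, norm_inv, norm_norm,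
        inv_mul_cancel₀ ht.ne'], by
      simp only [Set.mem_ofPred_eq, ← smul_sub, hsm, hSs]
      nlinarith⟩
    simp only [← smul_add, hsm, hSs] at h
    refine le_of_mul_le_mul_left ?_ htp
    linarith
  -- The division compensates for `‖a - b‖ ^ p ≤ 2 ^ (p - 1) * S (a, b)`.
  refine ⟨c / 2 ^ (p - 1), by positivity, fun a b => ?_⟩
  have h2 : (0 : ℝ) < 2 ^ (p - 1) := by positivity
  rcases le_total (δ * S (a, b)) (‖a - b‖ ^ p) with h | h
  · have h3 := hom a b h
    have h4 : ‖a - b‖ ^ p ≤ 2 ^ (p - 1) * S (a, b) := by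
      simpa [sub_eq_add_neg] using norm_add_rpow_le hp.le a (-b)
    have h5 : c / 2 ^ (p - 1) * (‖a - b‖ ^ p - δ * S (a, b)) ≤ c * S (a, b) := by
      have h6 : 0 ≤ δ * S (a, b) := by positivity
      calc _ ≤ c / 2 ^ (p - 1) * (2 ^ (p - 1) * S (a, b)) := by gcongr; linarith
        _ = _ := by field_simp
    linarith
  · have h3 := norm_add_rpow_le hp.le a b
    have h4 : c / 2 ^ (p - 1) * (‖a - b‖ ^ p - δ * S (a, b)) ≤ 0 :=
      mul_nonpos_of_nonneg_of_nonpos (by positivity) (by linarith)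
    linarith

variable {α F : Type*} [MeasurableSpace α] {μ : Measure α} [NormedAddCommGroup F]

theorem Lp_norm_rpow_eq_integral {p : ℝ} (hp : 0 < p) (f : Lp F (ENNReal.ofReal p) μ) :
    ‖f‖ ^ p = ∫ x, ‖f x‖ ^ p ∂μ := by
  have h := (Lp.memLp f).eLpNorm_eq_integral_rpow_norm (by simpa using hp) ENNReal.ofReal_ne_top
  rw [ENNReal.toReal_ofReal hp.le] at h
  rw [Lp.norm_def, h, ENNReal.toReal_ofReal (by positivity), ← Real.rpow_mul (by positivity),
    inv_mul_cancel₀ hp.ne', Real.rpow_one]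

/-- A form of the uniform convexity of `L^p`, for `1 < p < ∞`. -/
theorem Lp_exists_norm_add_rpow_add_le [NormedSpace ℝ F] [StrictConvexSpace ℝ F] [ProperSpace F]
    {p : ℝ} (hp : 1 < p) {δ : ℝ} (hδ : 0 < δ) :
    ∃ c : ℝ, 0 < c ∧ ∀ f g : Lp F (ENNReal.ofReal p) μ,
      ‖f + g‖ ^ p + c * (‖f - g‖ ^ p - δ * (‖f‖ ^ p + ‖g‖ ^ p)) ≤
        2 ^ (p - 1) * (‖f‖ ^ p + ‖g‖ ^ p) := by
  have hp0 : 0 < p := by linarith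
  obtain ⟨c, hc, h⟩ := exists_norm_add_rpow_add_le (F := F) hp hδ
  refine ⟨c, hc, fun f g => ?_⟩
  have hint : ∀ f : Lp F (ENNReal.ofReal p) μ, Integrable (fun x => ‖f x‖ ^ p) μ := fun f => by
    simpa [ENNReal.toReal_ofReal hp0.le] using
      (Lp.memLp f).integrable_norm_rpow (by simpa using hp0) ENNReal.ofReal_ne_top
  simp only [Lp_norm_rpow_eq_integral hp0]
  have hS : Integrable (fun x => ‖f x‖ ^ p + ‖g x‖ ^ p) μ := (hint f).add (hint g)
  have hT : Integrable
      (fun x => c * (‖(f - g) x‖ ^ p - δ * (‖f x‖ ^ p + ‖g x‖ ^ p))) μ :=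
    ((hint _).sub (hS.const_mul _)).const_mul _
  rw [← integral_add (hint f) (hint g), ← integral_const_mul, ← integral_const_mul,
    ← integral_sub (hint _) (hS.const_mul _), ← integral_const_mul, ← integral_add (hint _) hT]
  refine integral_mono_ae ((hint _).add hT) (hS.const_mul _) ?_
  filter_upwards [Lp.coeFn_add f g, Lp.coeFn_sub f g] with x h1 h2
  simpa only [h1, h2, Pi.add_apply, Pi.sub_apply] using h (f x) (g x)

/-- In a space satisfying the uniform convexity estimate, a bounded decreasing sequence of nonempty
closed convex sets has a common point. -/
theorem exists_mem_iInter_of_convex {X : Type*} [NormedAddCommGroup X] [NormedSpace ℝ X]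
    [CompleteSpace X] {p : ℝ} (hp : 1 < p)
    (H : ∀ δ : ℝ, 0 < δ → ∃ c : ℝ, 0 < c ∧ ∀ f g : X,
      ‖f + g‖ ^ p + c * (‖f - g‖ ^ p - δ * (‖f‖ ^ p + ‖g‖ ^ p)) ≤
        2 ^ (p - 1) * (‖f‖ ^ p + ‖g‖ ^ p))
    {D : ℕ → Set X} (hD : Antitone D) (hconv : ∀ n, Convex ℝ (D n)) (hcl : ∀ n, IsClosed (D n))
    (hne : ∀ n, (D n).Nonempty) {R : ℝ} (hR : ∀ x ∈ D 0, ‖x‖ ≤ R) : ∃ g, ∀ n, g ∈ D n := by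
  have hp0 : 0 < p := by linarith
  set e : ℕ → ℝ := fun n => Metric.infDist 0 (D n) with he
  have hle : ∀ n, ∀ x ∈ D n, e n ≤ ‖x‖ := fun n x hx => by
    simpa using Metric.infDist_le_dist_of_mem (x := (0 : X)) hx
  have hmono : Monotone e := fun n m hnm => Metric.infDist_le_infDist_of_subset (hD hnm) (hne m)
  have hbdd : BddAbove (Set.range e) := ⟨R, by
    rintro _ ⟨n, rfl⟩
    obtain ⟨x, hx⟩ := hne n
    exact (hle n x hx).trans (hR x (hD (Nat.zero_le n) hx))⟩
  have hlim := tendsto_atTop_ciSup hmono hbdd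
  set E := ⨆ n, e n
  have heE : ∀ n, e n ≤ E := fun n => le_ciSup hbdd n
  have he0 : ∀ n, 0 ≤ e n := fun n => Metric.infDist_nonneg
  have hE0 : 0 ≤ E := (he0 0).trans (heE 0)
  -- Points of almost minimal norm. The midpoint of `x n` and `x N` lies in `D N` for `n ≥ N`, so
  -- its norm is at least `e N`; as `e` converges, the convexity estimate forces the sequence to be
  -- Cauchy.
  have hx : ∀ n : ℕ, ∃ x ∈ D n, ‖x‖ < e n + 1 / ((n : ℝ) + 1) := fun n => by
    obtain ⟨x, hx, h⟩ := (Metric.infDist_lt_iff (x := (0 : X)) (hne n)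
      (r := e n + 1 / ((n : ℝ) + 1))).1 (lt_add_of_pos_right _ Nat.one_div_pos_of_nat)
    exact ⟨x, hx, by simpa using h⟩
  choose x hxD hxe using hx
  have hR0 : 0 ≤ R := (norm_nonneg _).trans (hR _ (hxD 0))
  have hxR : ∀ n, ‖x n‖ ≤ R := fun n => hR _ (hD (Nat.zero_le n) (hxD n))
  have hs : Tendsto (fun n : ℕ => (2 : ℝ) ^ p * ((E + 1 / ((n : ℝ) + 1)) ^ p - e n ^ p)) atTop
      (𝓝 0) := by
    have h1 : Tendsto (fun n : ℕ => (E + 1 / ((n : ℝ) + 1)) ^ p) atTop (𝓝 (E ^ p)) := by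
      have := (tendsto_const_nhds (x := E)).add tendsto_one_div_add_atTop_nhds_zero_nat
      rw [add_zero] at this
      exact this.rpow_const (Or.inr hp0.le)
    have h2 : Tendsto (fun n : ℕ => e n ^ p) atTop (𝓝 (E ^ p)) :=
      hlim.rpow_const (Or.inr hp0.le)
    simpa using (h1.sub h2).const_mul ((2 : ℝ) ^ p)
  have hcau : CauchySeq x := by
    refine Metric.cauchySeq_iff'.2 fun ε hε => ?_
    have hεp : 0 < ε ^ p := by positivity
    -- With this `δ` the error term `δ * (‖x n‖ ^ p + ‖x N‖ ^ p)` is at most `ε ^ p / 2`.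
    obtain ⟨c, hc, hH⟩ := H (ε ^ p / (4 * (R ^ p + 1))) (by positivity)
    obtain ⟨N, hN⟩ := (hs.eventually (gt_mem_nhds (show (0 : ℝ) < c * (ε ^ p / 2) by
      positivity))).exists
    refine ⟨N, fun n hn => ?_⟩
    rw [dist_eq_norm]
    refine lt_of_not_ge fun hge => ?_
    have h1 := hH (x n) (x N)
    have h2 : (2 * e N) ^ p ≤ ‖x n + x N‖ ^ p := by
      refine Real.rpow_le_rpow (by linarith [he0 N]) ?_ hp0.le
      have hmem := hconv N (hD hn (hxD n)) (hxD N) (half_pos one_pos).le (half_pos one_pos).le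
        (by norm_num)
      have := hle N _ hmem
      rw [← smul_add, norm_smul, Real.norm_of_nonneg (by norm_num)] at this
      linarith
    have h3 : ∀ k, N ≤ k → ‖x k‖ ^ p ≤ (E + 1 / ((N : ℝ) + 1)) ^ p := fun k hk => by
      refine Real.rpow_le_rpow (norm_nonneg _) ((hxe k).le.trans ?_) hp0.le
      exact add_le_add (heE k) (Nat.one_div_le_one_div hk)
    have h4 : ∀ k, ‖x k‖ ^ p ≤ R ^ p := fun k => Real.rpow_le_rpow (norm_nonneg _) (hxR k) hp0.le
    have h5 : ε ^ p ≤ ‖x n - x N‖ ^ p := Real.rpow_le_rpow hε.le hge hp0.le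
    have h6 : ε ^ p / (4 * (R ^ p + 1)) * (‖x n‖ ^ p + ‖x N‖ ^ p) ≤ ε ^ p / 2 := by
      have hRp : 0 ≤ R ^ p := by positivity
      calc _ ≤ ε ^ p / (4 * (R ^ p + 1)) * (2 * (R ^ p + 1)) := by
            gcongr
            linarith [h4 n, h4 N]
        _ = _ := by field_simp; norm_num
    rw [Real.mul_rpow (by norm_num) (he0 N)] at h2
    have h7 : (2 : ℝ) ^ (p - 1) * (‖x n‖ ^ p + ‖x N‖ ^ p) ≤
        2 ^ p * (E + 1 / ((N : ℝ) + 1)) ^ p := by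
      rw [Real.rpow_sub_one (by norm_num)]
      have h2p : (0 : ℝ) < 2 ^ p := by positivity
      nlinarith [h3 n hn, h3 N le_rfl]
    have h8 : c * (ε ^ p / 2) ≤
        c * (‖x n - x N‖ ^ p - ε ^ p / (4 * (R ^ p + 1)) * (‖x n‖ ^ p + ‖x N‖ ^ p)) := by
      gcongr
      linarith
    linarith
  obtain ⟨g, hg⟩ := cauchySeq_tendsto_of_complete hcau
  exact ⟨g, fun n => (hcl n).mem_of_tendsto hg
    (eventually_atTop.2 ⟨n, fun k hk => hD hk (hxD k)⟩)⟩

/-- A bounded sequence in `L^p`, `1 < p < ∞`, has a point in common to the closed convex hulls of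
all its tails. -/
theorem Lp_exists_mem_closure_convexHull [NormedSpace ℝ F] [StrictConvexSpace ℝ F] [ProperSpace F]
    {p : ℝ} (hp : 1 < p) [Fact (1 ≤ ENNReal.ofReal p)] (f : ℕ → Lp F (ENNReal.ofReal p) μ) {R : ℝ}
    (hf : ∀ n, ‖f n‖ ≤ R) : ∃ g, ∀ n, g ∈ closure (convexHull ℝ (f '' Set.Ici n)) := by
  refine exists_mem_iInter_of_convex (R := R) hp
    (fun δ hδ => Lp_exists_norm_add_rpow_add_le hp hδ)
    (fun n m hnm => closure_mono (convexHull_mono (Set.image_mono (Set.Ici_subset_Ici.2 hnm))))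
    (fun n => (convex_convexHull ℝ _).closure) (fun n => isClosed_closure)
    (fun n => ⟨f n, subset_closure (subset_convexHull ℝ _ ⟨n, Set.self_mem_Ici, rfl⟩)⟩) ?_
  have : closure (convexHull ℝ (f '' Set.Ici 0)) ⊆ Metric.closedBall 0 R := by
    refine closure_minimal (convexHull_min ?_ (convex_closedBall _ _)) Metric.isClosed_closedBall
    rintro _ ⟨n, -, rfl⟩
    simpa using hf n
  exact fun x hx => by simpa using this hx

/-- A bounded sequence in `L^p`, `1 < p < ∞`, has a point `g` such that every continuous linear map
which converges along the sequence takes at `g` the limit value. -/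
theorem Lp_exists_forall_apply_eq_of_tendsto [NormedSpace ℝ F] [StrictConvexSpace ℝ F]
    [ProperSpace F] {p : ℝ} (hp : 1 < p) [Fact (1 ≤ ENNReal.ofReal p)]
    (f : ℕ → Lp F (ENNReal.ofReal p) μ) {R : ℝ} (hf : ∀ n, ‖f n‖ ≤ R) :
    ∃ g : Lp F (ENNReal.ofReal p) μ, ∀ {Y : Type} [NormedAddCommGroup Y] [NormedSpace ℝ Y]
      (Λ : Lp F (ENNReal.ofReal p) μ →L[ℝ] Y) (y : Y),
      Tendsto (fun n => Λ (f n)) atTop (𝓝 y) → Λ g = y := by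
  obtain ⟨g, hg⟩ := Lp_exists_mem_closure_convexHull hp f hf
  refine ⟨g, fun {Y} _ _ Λ y hy => ?_⟩
  refine eq_of_forall_dist_le fun ε hε => ?_
  obtain ⟨N, hN⟩ := eventually_atTop.1 (hy.eventually (Metric.closedBall_mem_nhds y hε))
  have hsub : closure (convexHull ℝ (f '' Set.Ici N)) ⊆ Λ ⁻¹' Metric.closedBall y ε := by
    refine closure_minimal (convexHull_min ?_ ?_) (Metric.isClosed_closedBall.preimage Λ.continuous)
    · rintro _ ⟨n, hn, rfl⟩
      exact hN n hn
    · exact (convex_closedBall y ε).linear_preimage Λ.toLinearMap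
  exact hsub (hg N)

end UniformConvexity

/-! ### Monotonicity of the energy along multiples of the scale, and mean difference quotients. -/

section Energy

variable {d m : ℕ}

theorem convEnergy_univ (r p ε : ℝ) (u : EuclideanSpace ℝ (Fin d) → EuclideanSpace ℝ (Fin m)) :
    convEnergy r p ε u Set.univ =
      ∫⁻ ξ in Metric.ball (0 : EuclideanSpace ℝ (Fin d)) r, ∫⁻ x, ‖diffQuot ε ξ u x‖ₑ ^ p := by
  simp [convEnergy, shiftSet]

/-- Telescope into `n` increments of step `h`; by translation invariance they all have the same
norm. -/
theorem eLpNorm'_sub_translate_le {E F : Type*} [NormedAddCommGroup E] [MeasurableSpace E]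
    [BorelSpace E] {μ : Measure E} [μ.IsAddRightInvariant] [NormedAddCommGroup F]
    {p : ℝ} (hp : 1 ≤ p) {u : E → F} (hu : StronglyMeasurable u) (h : E) (n : ℕ) :
    eLpNorm' (fun x => u (x + n • h) - u x) p μ ≤ n * eLpNorm' (fun x => u (x + h) - u x) p μ := by
  have hm : ∀ a, StronglyMeasurable fun x => u (x + a) := fun a =>
    hu.comp_measurable (measurable_add_const a)
  induction n with
  | zero =>
    have hp0 : 0 < p := by linarith
    simp [eLpNorm', hp0]
  | succ n ih =>
    have e : (fun x => u (x + (n + 1) • h) - u x) =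
        (fun x => u (x + n • h + h) - u (x + n • h)) + fun x => u (x + n • h) - u x := by
      ext1 x
      simp [add_smul, add_assoc]
    have e2 : eLpNorm' (fun x => u (x + n • h + h) - u (x + n • h)) p μ =
        eLpNorm' (fun x => u (x + h) - u x) p μ := by
      simp only [eLpNorm']
      rw [lintegral_add_right_eq_self (μ := μ) (fun x => ‖u (x + h) - u x‖ₑ ^ p) (n • h)]
    rw [e]
    refine (eLpNorm'_add_le ?_ ((hm _).sub hu).aestronglyMeasurable hp).trans ?_
    · exact (((hm h).sub hu).comp_measurable (measurable_add_const (n • h))).aestronglyMeasurable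
    rw [e2]
    push_cast
    rw [add_mul, one_mul, add_comm]
    exact add_le_add ih le_rfl

/-- The factor `n` from telescoping cancels the `1 / n` of the difference quotient. This carries the
energy bound from the vanishing scale `ε` up to a fixed scale. -/
theorem convEnergy_nat_mul_le {r p ε : ℝ} (hp : 1 ≤ p) (hε : 0 < ε) {n : ℕ} (hn : 0 < n)
    {u : EuclideanSpace ℝ (Fin d) → EuclideanSpace ℝ (Fin m)} (hu : StronglyMeasurable u) :
    convEnergy r p (n * ε) u Set.univ ≤ convEnergy r p ε u Set.univ := by
  rw [convEnergy_univ, convEnergy_univ]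
  refine lintegral_mono fun ξ => ?_
  have hp0 : 0 < p := by linarith
  have h := eLpNorm'_sub_translate_le (μ := volume) hp hu (ε • ξ) n
  have key : eLpNorm' (diffQuot (n * ε) ξ u) p volume ≤ eLpNorm' (diffQuot ε ξ u) p volume := by
    have e : ∀ t : ℝ, diffQuot t ξ u = t⁻¹ • fun x => u (x + t • ξ) - u x := fun t => rfl
    have h1 : (n : ℝ) ≠ 0 := by positivity
    have h2 : (n : ℝ≥0∞) = ‖(n : ℝ)‖ₑ := by simp
    rw [e, e, eLpNorm'_const_smul _ hp0, eLpNorm'_const_smul _ hp0, mul_smul, Nat.cast_smul_eq_nsmul]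
    refine (mul_le_mul_right h _).trans (le_of_eq ?_)
    rw [← mul_assoc, h2, ← enorm_mul]
    congr 2
    field_simp
  simp only [eLpNorm'] at key
  rwa [ENNReal.rpow_le_rpow_iff (by positivity)] at key

theorem lintegral_rpow_le_measure_rpow_mul {α : Type*} [MeasurableSpace α] {μ : Measure α} {p : ℝ}
    (hp : 1 < p) {f : α → ℝ≥0∞} (hf : AEMeasurable f μ) :
    (∫⁻ a, f a ∂μ) ^ p ≤ μ Set.univ ^ (p - 1) * ∫⁻ a, f a ^ p ∂μ := by
  have hp0 : 0 < p := by linarith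
  have hpq := Real.HolderConjugate.conjExponent hp
  have h := ENNReal.lintegral_mul_le_Lp_mul_Lq μ hpq hf (aemeasurable_const (b := (1 : ℝ≥0∞)))
  simp only [Pi.mul_apply, mul_one, ENNReal.one_rpow, lintegral_const, one_mul] at h
  refine (ENNReal.rpow_le_rpow h hp0.le).trans (le_of_eq ?_)
  rw [ENNReal.mul_rpow_of_nonneg _ _ hp0.le, ← ENNReal.rpow_mul, ← ENNReal.rpow_mul,
    one_div_mul_cancel hp0.ne', ENNReal.rpow_one, mul_comm]
  congr 2
  rw [Real.conjExponent]
  have : p - 1 ≠ 0 := by linarith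
  field_simp

/-- The integral over a ball of the norm of the difference quotients. -/
noncomputable def diffQuotInt (r s : ℝ)
    (u : EuclideanSpace ℝ (Fin d) → EuclideanSpace ℝ (Fin m)) (x : EuclideanSpace ℝ (Fin d)) :
    ℝ≥0∞ :=
  ∫⁻ ξ in Metric.ball (0 : EuclideanSpace ℝ (Fin d)) r, ‖diffQuot s ξ u x‖ₑ

theorem measurable_enorm_diffQuot (s : ℝ)
    {u : EuclideanSpace ℝ (Fin d) → EuclideanSpace ℝ (Fin m)} (hu : StronglyMeasurable u) :
    Measurable fun z : EuclideanSpace ℝ (Fin d) × EuclideanSpace ℝ (Fin d) =>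
      ‖diffQuot s z.2 u z.1‖ₑ := by
  have := hu.measurable
  unfold diffQuot
  fun_prop

theorem measurable_diffQuotInt (r s : ℝ)
    {u : EuclideanSpace ℝ (Fin d) → EuclideanSpace ℝ (Fin m)} (hu : StronglyMeasurable u) :
    Measurable (diffQuotInt r s u) :=
  (measurable_enorm_diffQuot s hu).lintegral_prod_right'

/-- Hölder's inequality in `ξ` on the ball, then Tonelli. -/
theorem lintegral_diffQuotInt_rpow_le {r p s : ℝ} (hp : 1 < p)
    {u : EuclideanSpace ℝ (Fin d) → EuclideanSpace ℝ (Fin m)} (hu : StronglyMeasurable u) :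
    ∫⁻ x, diffQuotInt r s u x ^ p ≤
      volume (Metric.ball (0 : EuclideanSpace ℝ (Fin d)) r) ^ (p - 1) *
        convEnergy r p s u Set.univ := by
  have hm := measurable_enorm_diffQuot s hu
  rw [convEnergy_univ, lintegral_lintegral_swap (hm.comp measurable_swap |>.pow_const p
    |>.aemeasurable), ← lintegral_const_mul]
  · refine lintegral_mono fun x => ?_
    refine (lintegral_rpow_le_measure_rpow_mul hp
      (hm.comp measurable_prodMk_left).aemeasurable).trans ?_
    simp
  · exact (hm.pow_const p).lintegral_prod_right'

end Energy

/-! ### Mollification at scale `s` and its control by difference quotients. -/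

section Mollifier

variable {d m : ℕ}

/-- The convolution of `u` with the rescaling of `ρ` to scale `s`; see `mollify_eq_integral`. -/
noncomputable def mollify (ρ : EuclideanSpace ℝ (Fin d) → ℝ) (s : ℝ)
    (u : EuclideanSpace ℝ (Fin d) → EuclideanSpace ℝ (Fin m)) :
    EuclideanSpace ℝ (Fin d) → EuclideanSpace ℝ (Fin m) :=
  convolution (fun t => (s ^ d)⁻¹ * ρ ((-s⁻¹) • t)) u (ContinuousLinearMap.lsmul ℝ ℝ) volume

variable {ρ : EuclideanSpace ℝ (Fin d) → ℝ} {s : ℝ}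
  {u : EuclideanSpace ℝ (Fin d) → EuclideanSpace ℝ (Fin m)}

/-- Substitution `t = -sξ`. The sign turns the `x - t` of a convolution into the `x + sξ` of the
difference quotients. -/
theorem integral_comp_neg_smul_sub {G : Type*} [NormedAddCommGroup G] [NormedSpace ℝ G] (hs : 0 < s)
    (f : EuclideanSpace ℝ (Fin d) → EuclideanSpace ℝ (Fin d) → G) (x : EuclideanSpace ℝ (Fin d)) :
    ∫ t, f ((-s⁻¹) • t) (x - t) = (s ^ d) • ∫ ξ, f ξ (x + s • ξ) := by
  have h := Measure.integral_comp_smul (volume : Measure (EuclideanSpace ℝ (Fin d)))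
    (fun ξ => f ξ (x + s • ξ)) (-s⁻¹)
  have e : |((-s⁻¹) ^ Module.finrank ℝ (EuclideanSpace ℝ (Fin d)))⁻¹| = s ^ d := by
    simp [abs_inv, abs_pow, abs_of_pos hs]
  rw [e] at h
  rw [← h]
  refine integral_congr_ae (Eventually.of_forall fun t => ?_)
  simp [smul_smul, hs.ne', sub_eq_add_neg]

theorem mollify_eq_integral (hs : 0 < s) (x : EuclideanSpace ℝ (Fin d)) :
    mollify ρ s u x = ∫ ξ, ρ ξ • u (x + s • ξ) := by
  have h := integral_comp_neg_smul_sub hs (fun ξ y => (s ^ d)⁻¹ • ρ ξ • u y) x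
  simp only [mollify, convolution, ContinuousLinearMap.lsmul_apply]
  simp only [mul_smul]
  rw [h, integral_smul, smul_smul, mul_inv_cancel₀ (by positivity), one_smul]

theorem hasCompactSupport_scaled (hs : 0 < s) (hρc : HasCompactSupport ρ) :
    HasCompactSupport fun t => (s ^ d)⁻¹ * ρ ((-s⁻¹) • t) := by
  have h : HasCompactSupport fun t => ρ ((-s⁻¹) • t) :=
    hρc.comp_homeomorph (Homeomorph.smulOfNeZero (-s⁻¹) (by simp [hs.ne']))
  exact h.mul_left

theorem contDiff_scaled (hρ : ContDiff ℝ 1 ρ) :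
    ContDiff ℝ 1 fun t => (s ^ d)⁻¹ * ρ ((-s⁻¹) • t) := by
  fun_prop

theorem contDiff_mollify (hs : 0 < s) (hρ : ContDiff ℝ 1 ρ) (hρc : HasCompactSupport ρ)
    (hu : LocallyIntegrable u volume) : ContDiff ℝ 1 (mollify ρ s u) :=
  HasCompactSupport.contDiff_convolution_left (n := 1) _ (hasCompactSupport_scaled hs hρc)
    (contDiff_scaled hρ) hu

theorem fderiv_mollify_apply_eq_integral (hs : 0 < s) (hρ : ContDiff ℝ 1 ρ)
    (hρc : HasCompactSupport ρ) (hu : LocallyIntegrable u volume) (x v : EuclideanSpace ℝ (Fin d)) :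
    fderiv ℝ (mollify ρ s u) x v = -s⁻¹ • ∫ ξ, (fderiv ℝ ρ ξ v) • u (x + s • ξ) := by
  have hc := hasCompactSupport_scaled hs hρc
  have hd := contDiff_scaled (d := d) (s := s) hρ
  have h := hc.hasFDerivAt_convolution_left (ContinuousLinearMap.lsmul ℝ ℝ) (μ := volume) hd hu x
  have hconv : ConvolutionExistsAt (fderiv ℝ fun t => (s ^ d)⁻¹ * ρ ((-s⁻¹) • t)) u x
      ((ContinuousLinearMap.lsmul ℝ ℝ).precompL (EuclideanSpace ℝ (Fin d))) volume :=
    (hc.fderiv ℝ).convolutionExists_left _ (hd.continuous_fderiv one_ne_zero) hu x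
  have h' : fderiv ℝ (mollify ρ s u) x = _ := h.fderiv
  rw [h', convolution,
    ContinuousLinearMap.integral_apply hconv]
  have e : ∀ t, fderiv ℝ (fun t => (s ^ d)⁻¹ * ρ ((-s⁻¹) • t)) t v =
      (s ^ d)⁻¹ * (-s⁻¹ * fderiv ℝ ρ ((-s⁻¹) • t) v) := fun t => by
    have h1 : HasFDerivAt (fun t : EuclideanSpace ℝ (Fin d) => (-s⁻¹) • t)
      ((-s⁻¹) • ContinuousLinearMap.id ℝ _) t := (hasFDerivAt_id t).const_smul (-s⁻¹)
    have h2 := (((hρ.differentiable one_ne_zero) ((-s⁻¹) • t)).hasFDerivAt.comp t h1).const_mul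
      (s ^ d)⁻¹
    erw [h2.fderiv]
    simp
  simp only [ContinuousLinearMap.precompL_apply, ContinuousLinearMap.lsmul_apply, e]
  have h3 := integral_comp_neg_smul_sub hs
    (fun ξ y => ((s ^ d)⁻¹ * (-s⁻¹ * fderiv ℝ ρ ξ v)) • u y) x
  rw [h3]
  simp only [mul_smul]
  rw [integral_smul, smul_smul, mul_inv_cancel₀ (by positivity), one_smul, integral_smul]

theorem integrable_smul_translate {g : EuclideanSpace ℝ (Fin d) → ℝ} (hg : Continuous g)
    (hgc : HasCompactSupport g) (hs : 0 < s) (hu : LocallyIntegrable u volume)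
    (x : EuclideanSpace ℝ (Fin d)) : Integrable fun ξ => g ξ • u (x + s • ξ) := by
  have h : Integrable fun y => g (s⁻¹ • (y - x)) • u y := by
    refine hu.integrable_smul_left_of_hasCompactSupport (by fun_prop) ?_
    exact hgc.comp_homeomorph ((Homeomorph.subRight x).trans
      (Homeomorph.smulOfNeZero s⁻¹ (by simp [hs.ne'])))
  have h2 := (h.comp_add_left x).comp_smul hs.ne'
  simpa [smul_smul, hs.ne'] using h2

theorem enorm_integral_smul_le {r C : ℝ} {g : EuclideanSpace ℝ (Fin d) → ℝ}
    (hsupp : Function.support g ⊆ Metric.ball 0 r) (hC : ∀ ξ, ‖g ξ‖ ≤ C)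
    (h : EuclideanSpace ℝ (Fin d) → EuclideanSpace ℝ (Fin m)) :
    ‖∫ ξ, g ξ • h ξ‖ₑ ≤ ENNReal.ofReal C *
      ∫⁻ ξ in Metric.ball (0 : EuclideanSpace ℝ (Fin d)) r, ‖h ξ‖ₑ := by
  have e : ∫ ξ, g ξ • h ξ = ∫ ξ in Metric.ball (0 : EuclideanSpace ℝ (Fin d)) r, g ξ • h ξ := by
    refine (setIntegral_eq_integral_of_forall_compl_eq_zero fun ξ hξ => ?_).symm
    rw [Function.notMem_support.1 fun h => hξ (hsupp h), zero_smul]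
  rw [e, ← lintegral_const_mul' _ _ ENNReal.ofReal_ne_top]
  refine (enorm_integral_le_lintegral_enorm _).trans (lintegral_mono fun ξ => ?_)
  rw [enorm_smul]
  gcongr
  rw [← ofReal_norm]
  exact ENNReal.ofReal_le_ofReal (hC ξ)

/-- Since `∫ ρ = 1`, the difference is an average of increments of `u`, that is, `s` times an
average of difference quotients. -/
theorem enorm_mollify_sub_le {r C : ℝ} (hs : 0 < s) (hρ : Continuous ρ) (hρc : HasCompactSupport ρ)
    (hint : ∫ ξ, ρ ξ = 1) (hsupp : Function.support ρ ⊆ Metric.ball 0 r) (hC : ∀ ξ, ‖ρ ξ‖ ≤ C)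
    (hu : LocallyIntegrable u volume) (x : EuclideanSpace ℝ (Fin d)) :
    ‖mollify ρ s u x - u x‖ₑ ≤ ENNReal.ofReal (s * C) * diffQuotInt r s u x := by
  have e : mollify ρ s u x - u x = s • ∫ ξ, ρ ξ • diffQuot s ξ u x := by
    have h1 := integrable_smul_translate hρ hρc hs hu x
    have h2 : Integrable fun ξ => ρ ξ • u x :=
      (hρ.integrable_of_hasCompactSupport hρc).smul_const _
    have h3 : ∫ ξ, ρ ξ • u x = u x := by rw [integral_smul_const, hint, one_smul]
    rw [mollify_eq_integral hs, ← integral_smul]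
    rw [← congrArg (_ - ·) h3, ← integral_sub h1 h2]
    refine integral_congr_ae (Eventually.of_forall fun ξ => ?_)
    simp only [diffQuot]
    rw [smul_comm (ρ ξ), smul_smul, mul_inv_cancel₀ hs.ne', one_smul, smul_sub]
  rw [e, enorm_smul, ENNReal.ofReal_mul hs.le, mul_assoc, ← ofReal_norm s,
    Real.norm_of_nonneg hs.le]
  gcongr
  exact enorm_integral_smul_le hsupp hC _

/-- The derivative of `ρ` has integral zero, so `u x` can be subtracted inside the integral; the
increment then absorbs the factor `s⁻¹`, and the bound does not degenerate as `s → 0`. -/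
theorem enorm_fderiv_mollify_le {r C : ℝ} (hCpos : 0 < C) (hs : 0 < s) (hρ : ContDiff ℝ 1 ρ)
    (hρc : HasCompactSupport ρ) (hsupp : tsupport ρ ⊆ Metric.ball 0 r)
    (hC : ∀ ξ, ‖fderiv ℝ ρ ξ‖ ≤ C) (hu : LocallyIntegrable u volume)
    (x : EuclideanSpace ℝ (Fin d)) :
    ‖fderiv ℝ (mollify ρ s u) x‖ₑ ≤ ENNReal.ofReal C * diffQuotInt r s u x := by
  have hC0 : 0 ≤ C := hCpos.le
  -- Positivity of `C` matters here, because `0 * ⊤ = 0`.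
  by_cases htop : diffQuotInt r s u x = ⊤
  · rw [htop, ENNReal.mul_top (by simpa using hCpos)]
    exact le_top
  have hgc : ∀ v, Continuous fun ξ => fderiv ℝ ρ ξ v := fun v =>
    (hρ.continuous_fderiv one_ne_zero).clm_apply continuous_const
  have hgs : ∀ v, HasCompactSupport fun ξ => fderiv ℝ ρ ξ v := fun v =>
    hρc.fderiv_apply ℝ v
  -- Apply the derivative formula to a constant function, whose mollification is constant.
  have hzero : ∀ v (c : EuclideanSpace ℝ (Fin m)), ∫ ξ, (fderiv ℝ ρ ξ v) • c = 0 := fun v c => by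
    have h1 := fderiv_mollify_apply_eq_integral (u := fun _ => c) hs hρ hρc
      (locallyIntegrable_const c) x v
    have h2 : mollify ρ s (fun _ => c) = fun _ => ∫ ξ, ρ ξ • c :=
      funext fun y => mollify_eq_integral hs y
    rw [h2] at h1
    simpa [hs.ne'] using h1.symm
  have e : ∀ v, fderiv ℝ (mollify ρ s u) x v = -∫ ξ, (fderiv ℝ ρ ξ v) • diffQuot s ξ u x := by
    intro v
    have h1 := integrable_smul_translate (hgc v) (hgs v) hs hu x
    have h2 : Integrable fun ξ => (fderiv ℝ ρ ξ v) • u x :=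
      ((hgc v).integrable_of_hasCompactSupport (hgs v)).smul_const _
    rw [fderiv_mollify_apply_eq_integral hs hρ hρc hu, ← sub_zero (∫ ξ, _), ← hzero v (u x),
      ← integral_sub h1 h2, neg_smul, ← integral_smul]
    congr 1
    refine integral_congr_ae (Eventually.of_forall fun ξ => ?_)
    simp only [diffQuot]
    rw [smul_comm _ s⁻¹, smul_sub, smul_sub, smul_sub]
  rw [← ofReal_norm]
  refine ENNReal.ofReal_le_of_le_toReal ?_
  refine ContinuousLinearMap.opNorm_le_bound _ ENNReal.toReal_nonneg fun v => ?_
  rw [e, norm_neg]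
  have h1 := enorm_integral_smul_le (r := r) (C := C * ‖v‖) (g := fun ξ => fderiv ℝ ρ ξ v)
    (fun ξ hξ => hsupp (support_fderiv_subset ℝ fun h => hξ (by simp [h])))
    (fun ξ => (ContinuousLinearMap.le_opNorm _ _).trans (by gcongr; exact hC ξ))
    (fun ξ => diffQuot s ξ u x)
  have h2 := ENNReal.toReal_mono (ENNReal.mul_ne_top ENNReal.ofReal_ne_top htop) h1
  rw [toReal_enorm, ENNReal.toReal_mul, ENNReal.toReal_ofReal (by positivity)] at h2
  rw [ENNReal.toReal_mul, ENNReal.toReal_ofReal hC0]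
  linarith

theorem exists_mollifier (d : ℕ) {r : ℝ} (hr : 0 < r) :
    ∃ (ρ : EuclideanSpace ℝ (Fin d) → ℝ) (C : ℝ), 0 < C ∧ ContDiff ℝ 1 ρ ∧ HasCompactSupport ρ ∧
      tsupport ρ ⊆ Metric.ball 0 r ∧ ∫ ξ, ρ ξ = 1 ∧ (∀ ξ, ‖ρ ξ‖ ≤ C) ∧
      ∀ ξ, ‖fderiv ℝ ρ ξ‖ ≤ C := by
  let b : ContDiffBump (0 : EuclideanSpace ℝ (Fin d)) := ⟨r / 3, r / 2, by positivity, by linarith⟩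
  have h1 : ContDiff ℝ 1 (b.normed volume) := b.contDiff_normed
  have h2 : HasCompactSupport (b.normed volume) := b.hasCompactSupport_normed
  obtain ⟨C₁, hC₁⟩ := h1.continuous.bounded_above_of_compact_support h2
  obtain ⟨C₂, hC₂⟩ :=
    (h1.continuous_fderiv one_ne_zero).bounded_above_of_compact_support (h2.fderiv ℝ)
  refine ⟨b.normed volume, max 1 (max C₁ C₂), by positivity, h1, h2, ?_, b.integral_normed,
    fun ξ => (hC₁ ξ).trans (by simp), fun ξ => (hC₂ ξ).trans (by simp)⟩
  rw [b.tsupport_normed_eq]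
  exact Metric.closedBall_subset_ball (by change r / 2 < r; linarith)

end Mollifier

/-! ### The Sobolev inequality without compact support. -/

section Sobolev

variable {d m : ℕ}

theorem eLpNorm_le_of_enorm_le_diffQuotInt {G : Type*} [NormedAddCommGroup G] {r p s c : ℝ}
    (hp : 1 < p) {u : EuclideanSpace ℝ (Fin d) → EuclideanSpace ℝ (Fin m)}
    (hu : StronglyMeasurable u) {f : EuclideanSpace ℝ (Fin d) → G}
    (hf : ∀ x, ‖f x‖ₑ ≤ ENNReal.ofReal c * diffQuotInt r s u x) :
    eLpNorm f (ENNReal.ofReal p) volume ≤ ENNReal.ofReal c *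
      (volume (Metric.ball (0 : EuclideanSpace ℝ (Fin d)) r) ^ (p - 1) *
        convEnergy r p s u Set.univ) ^ p⁻¹ := by
  have hp0 : 0 < p := by linarith
  rw [eLpNorm_eq_lintegral_rpow_enorm_toReal (by simpa using hp0) ENNReal.ofReal_ne_top,
    ENNReal.toReal_ofReal hp0.le, one_div]
  calc (∫⁻ x, ‖f x‖ₑ ^ p) ^ p⁻¹
      ≤ (∫⁻ x, ENNReal.ofReal c ^ p * diffQuotInt r s u x ^ p) ^ p⁻¹ := by
        gcongr with x
        rw [← ENNReal.mul_rpow_of_nonneg _ _ hp0.le]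
        gcongr
        exact hf x
    _ = (ENNReal.ofReal c ^ p * ∫⁻ x, diffQuotInt r s u x ^ p) ^ p⁻¹ := by
        rw [lintegral_const_mul _ ((measurable_diffQuotInt r s hu).pow_const p)]
    _ ≤ (ENNReal.ofReal c ^ p * (volume (Metric.ball (0 : EuclideanSpace ℝ (Fin d)) r) ^ (p - 1) *
        convEnergy r p s u Set.univ)) ^ p⁻¹ := by
        gcongr
        exact lintegral_diffQuotInt_rpow_le hp hu
    _ = _ := by
        rw [ENNReal.mul_rpow_of_nonneg _ _ (by positivity), ENNReal.rpow_rpow_inv hp0.ne']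

/-- Dilations of one fixed bump: stretching by `n + 1` divides the gradient by `n + 1`. -/
theorem exists_cutoff_seq (d : ℕ) : ∃ (χ : ℕ → EuclideanSpace ℝ (Fin d) → ℝ) (t : ℕ → ℝ),
    (∀ n, ContDiff ℝ 1 (χ n)) ∧ (∀ n, HasCompactSupport (χ n)) ∧ (∀ n x, ‖χ n x‖ ≤ 1) ∧
    (∀ n x, ‖fderiv ℝ (χ n) x‖ ≤ t n) ∧ Tendsto t atTop (𝓝 0) ∧
    ∀ x, Tendsto (fun n => χ n x) atTop (𝓝 1) := by
  let b : ContDiffBump (0 : EuclideanSpace ℝ (Fin d)) := ⟨1, 2, one_pos, one_lt_two⟩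
  have h1 : ContDiff ℝ 1 b := b.contDiff
  obtain ⟨C, hC⟩ := (h1.continuous_fderiv one_ne_zero).bounded_above_of_compact_support
    (b.hasCompactSupport.fderiv ℝ)
  set t : ℕ → ℝ := fun n => 1 / ((n : ℝ) + 1)
  have ht : ∀ n, 0 < t n := fun n => Nat.one_div_pos_of_nat
  have ht0 : Tendsto t atTop (𝓝 0) := tendsto_one_div_add_atTop_nhds_zero_nat
  refine ⟨fun n x => b (t n • x), fun n => t n * C, fun n => h1.comp (contDiff_const_smul _),
    fun n => b.hasCompactSupport.comp_homeomorph (Homeomorph.smulOfNeZero (t n) (ht n).ne'),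
    fun n x => ?_, fun n x => ?_, by simpa using ht0.mul_const C, fun x => ?_⟩
  · rw [Real.norm_of_nonneg b.nonneg]
    exact b.le_one
  · have h2 : HasFDerivAt (fun x : EuclideanSpace ℝ (Fin d) => t n • x)
      (t n • ContinuousLinearMap.id ℝ _) x := (hasFDerivAt_id x).const_smul (t n)
    have h3 := ((h1.differentiable one_ne_zero) (t n • x)).hasFDerivAt.comp x h2
    have h4 : fderiv ℝ (fun x => b (t n • x)) x = _ := h3.fderiv
    rw [h4, ContinuousLinearMap.comp_smul, ContinuousLinearMap.comp_id, norm_smul,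
      Real.norm_of_nonneg (ht n).le]
    exact mul_le_mul_of_nonneg_left (hC _) (ht n).le
  · have h2 : Tendsto (fun n => b (t n • x)) atTop (𝓝 (b ((0 : ℝ) • x))) :=
      (h1.continuous.tendsto _).comp (ht0.smul_const x)
    rwa [zero_smul, b.one_of_mem_closedBall (by simp [b])] at h2

theorem eLpNorm_fderiv_smul_le {p : ℝ≥0∞} (hp : 1 ≤ p) {a : ℝ}
    {χ : EuclideanSpace ℝ (Fin d) → ℝ} {w : EuclideanSpace ℝ (Fin d) → EuclideanSpace ℝ (Fin m)}
    (hχ : ContDiff ℝ 1 χ) (hχ1 : ∀ x, ‖χ x‖ ≤ 1) (hχd : ∀ x, ‖fderiv ℝ χ x‖ ≤ a)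
    (hw : ContDiff ℝ 1 w) :
    eLpNorm (fderiv ℝ fun x => χ x • w x) p volume ≤
      eLpNorm (fderiv ℝ w) p volume + ENNReal.ofReal a * eLpNorm w p volume := by
  have ha : 0 ≤ a := (norm_nonneg _).trans (hχd 0)
  have hle : ∀ x, ‖fderiv ℝ (fun x => χ x • w x) x‖ ≤ ‖fderiv ℝ w x‖ + a * ‖w x‖ := fun x => by
    rw [fderiv_fun_smul (hχ.differentiable one_ne_zero x) (hw.differentiable one_ne_zero x)]
    refine (norm_add_le _ _).trans (add_le_add ?_ ?_)
    · rw [norm_smul]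
      exact mul_le_of_le_one_left (norm_nonneg _) (hχ1 _)
    · rw [ContinuousLinearMap.norm_smulRight_apply]
      gcongr
      exact hχd x
  have hc := (hw.continuous_fderiv one_ne_zero).norm
  refine (eLpNorm_mono_real hle).trans ((eLpNorm_add_le hc.aestronglyMeasurable
    (hw.continuous.norm.const_mul a).aestronglyMeasurable hp).trans ?_)
  rw [eLpNorm_norm]
  refine add_le_add le_rfl ?_
  refine eLpNorm_le_mul_eLpNorm_of_ae_le_mul (Eventually.of_forall fun x => ?_) _
  rw [norm_mul, norm_norm, Real.norm_of_nonneg ha]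

/-- The Gagliardo–Nirenberg–Sobolev inequality for `C^1` functions in `W^{1,p}`. -/
theorem eLpNorm_le_eLpNorm_fderiv_of_memLp {p : ℝ} (hp : 1 ≤ p) (hpd : p < d)
    {w : EuclideanSpace ℝ (Fin d) → EuclideanSpace ℝ (Fin m)} (hw : ContDiff ℝ 1 w)
    (hwp : MemLp w (ENNReal.ofReal p) volume) :
    eLpNorm w (ENNReal.ofReal (p * d / (d - p))) volume ≤
      eLpNormLESNormFDerivOfEqInnerConst
        (volume : Measure (EuclideanSpace ℝ (Fin d))) p.toNNReal *
        eLpNorm (fderiv ℝ w) (ENNReal.ofReal p) volume := by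
  have hp0 : 0 < p := by linarith
  have hd0 : (0 : ℝ) < d := by linarith
  have hsub : 0 < (d : ℝ) - p := by linarith
  obtain ⟨χ, t, hχ, hχc, hχ1, hχd, ht0, hχt⟩ := exists_cutoff_seq d
  generalize hK : eLpNormLESNormFDerivOfEqInnerConst
    (volume : Measure (EuclideanSpace ℝ (Fin d))) p.toNNReal = K
  -- The compactly supported inequality applies to `χ n • w`. The gradient of the cutoff contributes
  -- an error `t n * ‖w‖_p`, which vanishes in the limit because `w` is in `L^p`; Fatou then removes
  -- the cutoff.
  have hbound : ∀ n, eLpNorm (fun x => χ n x • w x) (ENNReal.ofReal (p * d / (d - p))) volume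
      ≤ K * (eLpNorm (fderiv ℝ w) (ENNReal.ofReal p) volume +
        ENNReal.ofReal (t n) * eLpNorm w (ENNReal.ofReal p) volume) := fun n => by
    have hpr : ((p * d / (d - p)).toNNReal : ℝ)⁻¹ = (p.toNNReal : ℝ)⁻¹ -
        (Module.finrank ℝ (EuclideanSpace ℝ (Fin d)) : ℝ)⁻¹ := by
      rw [Real.coe_toNNReal _ (by positivity), Real.coe_toNNReal _ hp0.le,
        finrank_euclideanSpace_fin]
      field_simp
    have h := eLpNorm_le_eLpNorm_fderiv_of_eq_inner (volume : Measure (EuclideanSpace ℝ (Fin d)))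
      ((hχ n).smul hw) (hχc n).smul_right (p := p.toNNReal) (by simpa using hp) (by simpa using hd0)
      (hpr.trans (by rw [NNReal.coe_inv]))
    rw [hK] at h
    refine h.trans (mul_le_mul_right ?_ _)
    exact eLpNorm_fderiv_smul_le (by simpa using hp) (hχ n) (hχ1 n) (hχd n) hw
  have hlim : Tendsto (fun n => (K : ℝ≥0∞) * (eLpNorm (fderiv ℝ w) (ENNReal.ofReal p) volume +
      ENNReal.ofReal (t n) * eLpNorm w (ENNReal.ofReal p) volume)) atTop
      (𝓝 (K * eLpNorm (fderiv ℝ w) (ENNReal.ofReal p) volume)) := by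
    have h1 : Tendsto (fun n => ENNReal.ofReal (t n)) atTop (𝓝 0) := by
      simpa using ENNReal.tendsto_ofReal ht0
    have h2 := ENNReal.Tendsto.mul_const h1 (b := eLpNorm w (ENNReal.ofReal p) volume)
      (Or.inr hwp.2.ne)
    rw [zero_mul] at h2
    have h3 := (tendsto_const_nhds (x := eLpNorm (fderiv ℝ w) (ENNReal.ofReal p) volume)).add h2
    rw [add_zero] at h3
    exact ENNReal.Tendsto.const_mul h3 (Or.inr ENNReal.coe_ne_top)
  rw [← hlim.liminf_eq]
  refine (Lp.eLpNorm_lim_le_liminf_eLpNorm (f := fun n x => χ n x • w x)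
    (fun n => ((hχ n).continuous.smul hw.continuous).aestronglyMeasurable) w
    (Eventually.of_forall fun x => ?_)).trans (liminf_le_liminf (Eventually.of_forall hbound))
  simpa using (hχt x).smul_const (w x)

end Sobolev

/-! ### Local sup and Lipschitz bounds at a fixed scale. -/

section LocalBounds

variable {d m : ℕ} {ρ : EuclideanSpace ℝ (Fin d) → ℝ} {r s R C : ℝ}
  {u : EuclideanSpace ℝ (Fin d) → EuclideanSpace ℝ (Fin m)}

/-- Substitute `y = x + sξ`, which stays in the ball of radius `R + s * r`. -/
theorem lintegral_ball_enorm_comp_le (hs : 0 < s) (hu : StronglyMeasurable u)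
    {x : EuclideanSpace ℝ (Fin d)} (hx : ‖x‖ ≤ R) :
    ∫⁻ ξ in Metric.ball (0 : EuclideanSpace ℝ (Fin d)) r, ‖u (x + s • ξ)‖ₑ ≤
      ENNReal.ofReal (s ^ d)⁻¹ * ∫⁻ y in Metric.closedBall 0 (R + s * r), ‖u y‖ₑ := by
  set f : EuclideanSpace ℝ (Fin d) → ℝ≥0∞ :=
    (Metric.closedBall 0 (R + s * r)).indicator fun y => ‖u y‖ₑ with hf
  have hfm : Measurable f := hu.enorm.indicator Metric.isClosed_closedBall.measurableSet
  rw [← lintegral_indicator Metric.isOpen_ball.measurableSet,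
    ← lintegral_indicator Metric.isClosed_closedBall.measurableSet]
  have h1 : ∫⁻ ξ, f (x + s • ξ) = ENNReal.ofReal (s ^ d)⁻¹ * ∫⁻ y, f y := by
    rw [← lintegral_add_left_eq_self f x]
    have h2 := Measure.map_addHaar_smul (volume : Measure (EuclideanSpace ℝ (Fin d))) hs.ne'
    have h3 := lintegral_map (μ := volume) (hfm.comp (measurable_const_add x))
      (measurable_const_smul (M := ℝ) (α := EuclideanSpace ℝ (Fin d)) s)
    rw [h2, lintegral_smul_measure, finrank_euclideanSpace_fin,
      abs_of_pos (by positivity)] at h3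
    exact h3.symm
  rw [← h1]
  refine lintegral_mono fun ξ => ?_
  by_cases hξ : ξ ∈ Metric.ball (0 : EuclideanSpace ℝ (Fin d)) r
  swap
  · simp [Set.indicator_of_notMem hξ]
  rw [Set.indicator_of_mem hξ, hf, Set.indicator_of_mem]
  rw [mem_ball_zero_iff] at hξ
  rw [mem_closedBall_zero_iff]
  refine (norm_add_le _ _).trans (add_le_add hx ?_)
  rw [norm_smul, Real.norm_of_nonneg hs.le]
  exact mul_le_mul_of_nonneg_left hξ.le hs.le

/-- Only a local `L^1` bound is used. The constant blows up as `s → 0`, which is harmless for scales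
bounded below. -/
theorem norm_mollify_le_of_lintegral_le (hs : 0 < s) (hu : StronglyMeasurable u) (hC0 : 0 ≤ C)
    (hsupp : Function.support ρ ⊆ Metric.ball 0 r) (hC : ∀ ξ, ‖ρ ξ‖ ≤ C) {A : ℝ} (hA0 : 0 ≤ A)
    (hA : ∫⁻ y in Metric.closedBall 0 (R + s * r), ‖u y‖ₑ ≤ ENNReal.ofReal A)
    {x : EuclideanSpace ℝ (Fin d)} (hx : ‖x‖ ≤ R) :
    ‖mollify ρ s u x‖ ≤ C * ((s ^ d)⁻¹ * A) := by
  rw [mollify_eq_integral hs, ← ENNReal.ofReal_le_ofReal_iff (by positivity), ofReal_norm,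
    ENNReal.ofReal_mul hC0, ENNReal.ofReal_mul (by positivity)]
  refine (enorm_integral_smul_le hsupp hC _).trans ?_
  gcongr
  exact (lintegral_ball_enorm_comp_le hs hu hx).trans (by gcongr)

theorem norm_fderiv_mollify_le_of_lintegral_le (hs : 0 < s) (hu : StronglyMeasurable u)
    (hul : LocallyIntegrable u volume) (hC0 : 0 ≤ C) (hρ : ContDiff ℝ 1 ρ)
    (hρc : HasCompactSupport ρ) (hsupp : tsupport ρ ⊆ Metric.ball 0 r)
    (hC : ∀ ξ, ‖fderiv ℝ ρ ξ‖ ≤ C) {A : ℝ} (hA0 : 0 ≤ A)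
    (hA : ∫⁻ y in Metric.closedBall 0 (R + s * r), ‖u y‖ₑ ≤ ENNReal.ofReal A)
    {x : EuclideanSpace ℝ (Fin d)} (hx : ‖x‖ ≤ R) :
    ‖fderiv ℝ (mollify ρ s u) x‖ ≤ s⁻¹ * (C * ((s ^ d)⁻¹ * A)) := by
  refine ContinuousLinearMap.opNorm_le_bound _ (by positivity) fun v => ?_
  rw [fderiv_mollify_apply_eq_integral hs hρ hρc hul, norm_smul, norm_neg,
    Real.norm_of_nonneg (by positivity), mul_assoc]
  refine mul_le_mul_of_nonneg_left ?_ (by positivity)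
  rw [mul_right_comm, ← ENNReal.ofReal_le_ofReal_iff (by positivity), ofReal_norm,
    ENNReal.ofReal_mul (by positivity)]
  refine (enorm_integral_smul_le (r := r) (C := C * ‖v‖) (g := fun ξ => fderiv ℝ ρ ξ v)
    (fun ξ hξ => hsupp (support_fderiv_subset ℝ fun h => hξ (by simp [h])))
    (fun ξ => (ContinuousLinearMap.le_opNorm _ _).trans (by gcongr; exact hC ξ)) _).trans ?_
  rw [ENNReal.ofReal_mul (p := (s ^ d)⁻¹) (by positivity)]
  gcongr
  exact (lintegral_ball_enorm_comp_le hs hu hx).trans (by gcongr)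

theorem norm_mollify_sub_le_of_lintegral_le (hs : 0 < s) (hu : StronglyMeasurable u)
    (hul : LocallyIntegrable u volume) (hC0 : 0 ≤ C) (hρ : ContDiff ℝ 1 ρ)
    (hρc : HasCompactSupport ρ) (hsupp : tsupport ρ ⊆ Metric.ball 0 r)
    (hC : ∀ ξ, ‖fderiv ℝ ρ ξ‖ ≤ C) {A : ℝ} (hA0 : 0 ≤ A)
    (hA : ∫⁻ y in Metric.closedBall 0 (R + s * r), ‖u y‖ₑ ≤ ENNReal.ofReal A)
    {x y : EuclideanSpace ℝ (Fin d)} (hx : ‖x‖ ≤ R) (hy : ‖y‖ ≤ R) :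
    ‖mollify ρ s u x - mollify ρ s u y‖ ≤ s⁻¹ * (C * ((s ^ d)⁻¹ * A)) * ‖x - y‖ :=
  (convex_closedBall (0 : EuclideanSpace ℝ (Fin d)) R).norm_image_sub_le_of_norm_fderiv_le
    (fun z _ => (contDiff_mollify hs hρ hρc hul).differentiable one_ne_zero z)
    (fun z hz => norm_fderiv_mollify_le_of_lintegral_le hs hu hul hC0 hρ hρc hsupp hC hA0 hA
      (by simpa using hz)) (by simpa using hy) (by simpa using hx)

end LocalBounds

/-! ### Criteria for total boundedness. -/

section TotallyBounded

/-- A finite net for `a` with centres among the `a i` is carried to `f` through the indices, so no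
map from `X` to `Y` is needed. -/
theorem totallyBounded_range_of_dist_le {ι X Y : Type*} [PseudoMetricSpace X] [PseudoMetricSpace Y]
    {a : ι → X} {f : ι → Y} {C : ℝ} (hC : 0 ≤ C) (h : ∀ i j, dist (f i) (f j) ≤ C * dist (a i) (a j))
    (ha : TotallyBounded (Set.range a)) : TotallyBounded (Set.range f) := by
  refine Metric.totallyBounded_iff.2 fun ε hε => ?_
  obtain ⟨t, htA, htf, ht⟩ := totallyBounded_iff_subset.1 ha _
    (Metric.dist_mem_uniformity (show 0 < ε / (C + 1) by positivity))
  obtain ⟨I, hI⟩ : ∃ I : Set ι, a '' I = t := Set.subset_range_iff_exists_image_eq.1 htA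
  obtain ⟨J, -, hJf, hJ⟩ : ∃ J ⊆ I, J.Finite ∧ a '' J = t := by
    subst hI
    obtain ⟨J, hJ, hinj⟩ := Set.SurjOn.exists_bijOn_subset (Set.surjOn_image a I)
    exact ⟨J, hJ, hinj.finite_iff_finite.2 htf, hinj.image_eq⟩
  refine ⟨f '' J, hJf.image f, ?_⟩
  rintro _ ⟨i, rfl⟩
  have h1 := ht ⟨i, rfl⟩
  simp only [← hJ, Set.mem_iUnion, exists_prop, Set.exists_mem_image] at h1 ⊢
  obtain ⟨j, hj, hij⟩ := h1
  refine ⟨j, hj, ?_⟩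
  have h2 : dist (a i) (a j) < ε / (C + 1) := hij
  rw [Metric.mem_ball]
  calc _ ≤ C * dist (a i) (a j) := h i j
    _ ≤ C * (ε / (C + 1)) := by gcongr
    _ < ε := by
      rw [mul_div_assoc', div_lt_iff₀ (by positivity)]
      linarith

theorem totallyBounded_of_forall_exists_dist_le {X : Type*} [PseudoMetricSpace X] {S : Set X}
    (h : ∀ δ > 0, ∃ T : Set X, TotallyBounded T ∧ ∀ x ∈ S, ∃ y ∈ T, dist x y ≤ δ) :
    TotallyBounded S := by
  refine Metric.totallyBounded_iff.2 fun ε hε => ?_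
  obtain ⟨T, hT, hST⟩ := h (ε / 2) (half_pos hε)
  obtain ⟨t, htf, ht⟩ := Metric.totallyBounded_iff.1 hT (ε / 2) (half_pos hε)
  refine ⟨t, htf, fun x hx => ?_⟩
  obtain ⟨y, hy, hxy⟩ := hST x hx
  have h1 := ht hy
  simp only [Set.mem_iUnion, exists_prop, Metric.mem_ball] at h1 ⊢
  obtain ⟨z, hz, hyz⟩ := h1
  exact ⟨z, hz, by linarith [dist_triangle x y z]⟩

/-- Equibounded and equi-Lipschitz functions on a compact set form a totally bounded subset of
`L^p`. -/
theorem totallyBounded_range_Lp_of_lipschitz {E F ι : Type*} [PseudoMetricSpace E]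
    [MeasurableSpace E] [OpensMeasurableSpace E] [NormedAddCommGroup F] [ProperSpace F]
    {μ : Measure E} {K : Set E}
    (hK : IsCompact K) (hμK : μ K ≠ ⊤) {p : ℝ≥0∞} [Fact (1 ≤ p)] {w : ι → E → F} {B L : ℝ}
    (hB : ∀ i, ∀ x ∈ K, ‖w i x‖ ≤ B)
    (hL : ∀ i, ∀ x ∈ K, ∀ y ∈ K, ‖w i x - w i y‖ ≤ L * dist x y) {f : ι → Lp F p (μ.restrict K)}
    (hf : ∀ i, f i =ᵐ[μ.restrict K] w i) (hKm : MeasurableSet K) :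
    TotallyBounded (Set.range f) := by
  have : CompactSpace K := isCompact_iff_compactSpace.1 hK
  have hlip : ∀ i, LipschitzWith L.toNNReal (K.domRestrict (w i)) := fun i =>
    LipschitzWith.of_dist_le_mul fun x y => by
      rw [dist_eq_norm]
      exact (hL i x x.2 y y.2).trans (mul_le_mul_of_nonneg_right (Real.le_coe_toNNReal L)
        dist_nonneg)
  let a : ι → BoundedContinuousFunction K F := fun i =>
    BoundedContinuousFunction.mkOfCompact ⟨K.domRestrict (w i), (hlip i).continuous⟩
  have hA : IsCompact (closure (Set.range a)) := by
    refine BoundedContinuousFunction.arzela_ascoli _ (isCompact_closedBall (0 : F) B) _ ?_ ?_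
    · rintro _ x ⟨i, rfl⟩
      exact mem_closedBall_zero_iff.2 (hB i x x.2)
    · refine UniformEquicontinuous.equicontinuous ?_
      refine LipschitzWith.uniformEquicontinuous _ L.toNNReal ?_
      rintro ⟨_, i, rfl⟩
      exact hlip i
  -- On `K` the `L^p` distance is at most `μ(K) ^ (1/p)` times the sup distance.
  refine totallyBounded_range_of_dist_le (a := a) (C := (μ K ^ p.toReal⁻¹).toReal)
    ENNReal.toReal_nonneg (fun i j => ?_) (hA.totallyBounded.subset subset_closure)
  rw [Lp.dist_def]
  have hae : ∀ᵐ x ∂μ.restrict K, ‖(f i - f j : E → F) x‖ ≤ dist (a i) (a j) := by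
    filter_upwards [hf i, hf j, ae_restrict_mem hKm] with x hi hj hx
    rw [Pi.sub_apply, hi, hj, ← dist_eq_norm]
    exact BoundedContinuousFunction.dist_coe_le_dist (f := a i) (g := a j) ⟨x, hx⟩
  have h1 := eLpNorm_le_of_ae_bound (p := p) hae
  rw [Measure.restrict_apply_univ] at h1
  have h2 : μ K ^ p.toReal⁻¹ ≠ ⊤ := ENNReal.rpow_ne_top_of_nonneg (by positivity) hμK
  have h3 := ENNReal.toReal_mono (ENNReal.mul_ne_top h2 ENNReal.ofReal_ne_top) h1
  rwa [ENNReal.toReal_mul, ENNReal.toReal_ofReal dist_nonneg] at h3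

end TotallyBounded

/-! ### `L^p_loc` as a closed subspace of the product of the spaces `L^p(K)`. -/

section LocalTopology

variable {d m : ℕ} {p : ℝ≥0∞}

open TopologicalSpace (Compacts)

theorem LpLoc.coeFn_restrict (K : Compacts (EuclideanSpace ℝ (Fin d))) (f : LpLoc d m p) :
    LpLoc.restrict K f =ᵐ[volume.restrict (K : Set (EuclideanSpace ℝ (Fin d)))] f.1 :=
  MemLp.coeFn_toLp _

theorem LpLoc.isInducing_restrict [Fact (1 ≤ p)] :
    IsInducing fun (f : LpLoc d m p) (K : Compacts (EuclideanSpace ℝ (Fin d))) =>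
      LpLoc.restrict K f := by
  refine ⟨?_⟩
  simp only [Pi.topologicalSpace, induced_iInf, induced_compose]
  rfl

theorem LpLoc.tendsto_iff [Fact (1 ≤ p)] {ι : Type*} {l : Filter ι} {f : ι → LpLoc d m p} {g : LpLoc d m p} :
    Tendsto f l (𝓝 g) ↔ ∀ K : Compacts (EuclideanSpace ℝ (Fin d)),
      Tendsto (fun i => LpLoc.restrict K (f i)) l (𝓝 (LpLoc.restrict K g)) := by
  rw [LpLoc.isInducing_restrict.tendsto_nhds_iff, tendsto_pi_nhds]
  rfl

/-- The natural map `L^p(ν) → L^p(μ)` is 1-Lipschitz, and the set is its graph with the coordinates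
exchanged. -/
theorem isClosed_setOf_Lp_ae_eq [Fact (1 ≤ p)] {α F : Type*} [MeasurableSpace α] [NormedAddCommGroup F]
    {μ ν : Measure α} (h : μ ≤ ν) :
    IsClosed {z : Lp F p μ × Lp F p ν | z.1 =ᵐ[μ] z.2} := by
  let T : Lp F p ν → Lp F p μ := fun f => ((Lp.memLp f).mono_measure h).toLp f
  have hT : LipschitzWith 1 T := fun f g => by
    rw [ENNReal.coe_one, one_mul, Lp.edist_toLp_toLp, Lp.edist_def]
    exact eLpNorm_mono_measure _ h
  have e : {z : Lp F p μ × Lp F p ν | z.1 =ᵐ[μ] z.2} = {z | z.1 = T z.2} := by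
    ext z
    rw [Set.mem_ofPred_eq, Set.mem_ofPred_eq]
    refine ⟨fun hz => Lp.ext (hz.trans (MemLp.coeFn_toLp _).symm), fun hz => ?_⟩
    rw [hz]
    exact MemLp.coeFn_toLp _
  rw [e]
  exact isClosed_eq continuous_fst (hT.continuous.comp continuous_snd)

/-- A gluing property: compatible families come from one function because countably many balls cover
the space, so the exceptional null sets add up to a null set. -/
theorem LpLoc.range_restrict :
    (Set.range fun (f : LpLoc d m p) (K : Compacts (EuclideanSpace ℝ (Fin d))) =>
      LpLoc.restrict K f) =
    {F | ∀ K K' : Compacts (EuclideanSpace ℝ (Fin d)), K ≤ K' →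
      F K =ᵐ[volume.restrict (K : Set (EuclideanSpace ℝ (Fin d)))] F K'} := by
  refine Set.Subset.antisymm ?_ fun F hF => ?_
  · rintro _ ⟨f, rfl⟩ K K' hK
    have h1 : LpLoc.restrict K' f =ᵐ[volume.restrict (K : Set (EuclideanSpace ℝ (Fin d)))] f.1 :=
      ae_mono (Measure.restrict_mono hK le_rfl) (f.coeFn_restrict K')
    exact (f.coeFn_restrict K).trans h1.symm
  let B : ℕ → Compacts (EuclideanSpace ℝ (Fin d)) := fun n =>
    ⟨Metric.closedBall 0 n, isCompact_closedBall _ _⟩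
  -- At `x`, use the member of the family on the smallest ball of natural radius containing `x`.
  let g : EuclideanSpace ℝ (Fin d) → EuclideanSpace ℝ (Fin m) := fun x => F (B ⌈‖x‖⌉₊) x
  have hg : ∀ K : Compacts (EuclideanSpace ℝ (Fin d)),
      F K =ᵐ[volume.restrict (K : Set (EuclideanSpace ℝ (Fin d)))] g := fun K => by
    have h1 : ∀ n, ∀ᵐ x ∂volume.restrict (K : Set (EuclideanSpace ℝ (Fin d))),
        x ∈ (B n : Set (EuclideanSpace ℝ (Fin d))) → F K x = F (B n) x := fun n => by
      have h2 := (hF (B n ⊓ K) K inf_le_right).symm.trans (hF (B n ⊓ K) (B n) inf_le_left)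
      rw [Compacts.coe_inf, ← Measure.restrict_restrict (B n).isCompact.measurableSet] at h2
      exact (ae_restrict_iff' (B n).isCompact.measurableSet).1 h2
    filter_upwards [ae_all_iff.2 h1] with x hx
    exact hx ⌈‖x‖⌉₊ (by simpa [B] using Nat.le_ceil ‖x‖)
  have hU : ⋃ n, (B n : Set (EuclideanSpace ℝ (Fin d))) = Set.univ :=
    Metric.iUnion_closedBall_nat 0
  have hgm : AEStronglyMeasurable g volume := by
    rw [← Measure.restrict_univ (μ := volume), ← hU, aestronglyMeasurable_iUnion_iff]
    exact fun n => (Lp.aestronglyMeasurable (F (B n))).congr (hg _)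
  have hgK : ∀ K : Compacts (EuclideanSpace ℝ (Fin d)),
      F K =ᵐ[volume.restrict (K : Set (EuclideanSpace ℝ (Fin d)))] AEEqFun.mk g hgm := fun K =>
    (hg K).trans (ae_restrict_of_ae (AEEqFun.coeFn_mk g hgm).symm)
  refine ⟨⟨AEEqFun.mk g hgm, fun K hK => (Lp.memLp (F ⟨K, hK⟩)).ae_eq (hgK ⟨K, hK⟩)⟩,
    funext fun K => Lp.ext ?_⟩
  exact (LpLoc.coeFn_restrict K _).trans (hgK K).symm

/-- By Tychonoff the product of the compact closures in the `L^p(K)` is compact, and its preimage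
under an inducing map with closed range is compact. -/
theorem LpLoc.isCompact_closure [Fact (1 ≤ p)] {S : Set (LpLoc d m p)}
    (h : ∀ K : Compacts (EuclideanSpace ℝ (Fin d)), TotallyBounded (LpLoc.restrict K '' S)) :
    IsCompact (closure S) := by
  have hcl : IsClosed (Set.range fun (f : LpLoc d m p)
      (K : Compacts (EuclideanSpace ℝ (Fin d))) => LpLoc.restrict K f) := by
    rw [LpLoc.range_restrict]
    simp only [Set.ofPred_forall]
    refine isClosed_iInter fun K => isClosed_iInter fun K' => isClosed_iInter fun hK => ?_
    have hc : Continuous fun F : ∀ K : Compacts (EuclideanSpace ℝ (Fin d)),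
        Lp (EuclideanSpace ℝ (Fin m)) p (volume.restrict (K : Set (EuclideanSpace ℝ (Fin d)))) =>
        (F K, F K') := (continuous_apply K).prodMk (continuous_apply K')
    exact (isClosed_setOf_Lp_ae_eq (Measure.restrict_mono (μ := volume) hK le_rfl)).preimage hc
  have hC : ∀ K, IsCompact (closure (LpLoc.restrict K '' S)) := fun K =>
    (h K).closure.isCompact_of_isClosed isClosed_closure
  have hpre := LpLoc.isInducing_restrict.isCompact_preimage hcl (isCompact_univ_pi hC)
  have : R1Space (LpLoc d m p) := LpLoc.isInducing_restrict.r1Space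
  exact hpre.closure_of_subset fun f hf K _ => subset_closure ⟨f, hf, rfl⟩

end LocalTopology

/-! ### Total boundedness of the sequence on each compact set. -/

section Compactness

variable {d m : ℕ}

/-- The bound for the `L^p` norm of `diffQuotInt r s u` in terms of a bound `G` for the energy. -/
noncomputable def energyBound (d : ℕ) (r p : ℝ) (G : ℝ≥0∞) : ℝ≥0∞ :=
  (volume (Metric.ball (0 : EuclideanSpace ℝ (Fin d)) r) ^ (p - 1) * G) ^ p⁻¹

theorem energyBound_ne_top {r p : ℝ} {G : ℝ≥0∞} (hp : 1 ≤ p) (hG : G ≠ ⊤) :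
    energyBound d r p G ≠ ⊤ :=
  ENNReal.rpow_ne_top_of_nonneg (by positivity) (ENNReal.mul_ne_top
    (ENNReal.rpow_ne_top_of_nonneg (by linarith) measure_ball_lt_top.ne) hG)

variable {ρ : EuclideanSpace ℝ (Fin d) → ℝ} {r s C p : ℝ}
  {u : EuclideanSpace ℝ (Fin d) → EuclideanSpace ℝ (Fin m)} {G : ℝ≥0∞}

theorem eLpNorm_mollify_sub_le (hp : 1 < p) (hs : 0 < s) (hρ : Continuous ρ)
    (hρc : HasCompactSupport ρ) (hint : ∫ ξ, ρ ξ = 1)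
    (hsupp : Function.support ρ ⊆ Metric.ball 0 r) (hC : ∀ ξ, ‖ρ ξ‖ ≤ C)
    (hu : StronglyMeasurable u) (hul : LocallyIntegrable u volume)
    (hG : convEnergy r p s u Set.univ ≤ G) :
    eLpNorm (mollify ρ s u - u) (ENNReal.ofReal p) volume ≤
      ENNReal.ofReal (s * C) * energyBound d r p G := by
  have hp0 : 0 < p := by linarith
  refine (eLpNorm_le_of_enorm_le_diffQuotInt hp hu
    (enorm_mollify_sub_le hs hρ hρc hint hsupp hC hul)).trans ?_
  unfold energyBound
  gcongr

theorem eLpNorm_fderiv_mollify_le (hp : 1 < p) (hs : 0 < s) (hCpos : 0 < C) (hρ : ContDiff ℝ 1 ρ)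
    (hρc : HasCompactSupport ρ) (hsupp : tsupport ρ ⊆ Metric.ball 0 r)
    (hC : ∀ ξ, ‖fderiv ℝ ρ ξ‖ ≤ C)
    (hu : StronglyMeasurable u) (hul : LocallyIntegrable u volume)
    (hG : convEnergy r p s u Set.univ ≤ G) :
    eLpNorm (fderiv ℝ (mollify ρ s u)) (ENNReal.ofReal p) volume ≤
      ENNReal.ofReal C * energyBound d r p G := by
  have hp0 : 0 < p := by linarith
  refine (eLpNorm_le_of_enorm_le_diffQuotInt hp hu
    (enorm_fderiv_mollify_le hCpos hs hρ hρc hsupp hC hul)).trans ?_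
  unfold energyBound
  gcongr

theorem memLp_mollify (hp : 1 < p) (hs : 0 < s) (hρ : ContDiff ℝ 1 ρ)
    (hρc : HasCompactSupport ρ) (hint : ∫ ξ, ρ ξ = 1)
    (hsupp : Function.support ρ ⊆ Metric.ball 0 r) (hC : ∀ ξ, ‖ρ ξ‖ ≤ C)
    (hu : StronglyMeasurable u) (hup : MemLp u (ENNReal.ofReal p) volume)
    (hul : LocallyIntegrable u volume)
    (hG : convEnergy r p s u Set.univ ≤ G) (hGtop : G ≠ ⊤) :
    MemLp (mollify ρ s u) (ENNReal.ofReal p) volume := by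
  have h : MemLp (mollify ρ s u - u) (ENNReal.ofReal p) volume :=
    ⟨(contDiff_mollify hs hρ hρc hul).continuous.aestronglyMeasurable.sub hup.1,
      (eLpNorm_mollify_sub_le hp hs hρ.continuous hρc hint hsupp hC hu hul hG).trans_lt
        (ENNReal.mul_lt_top ENNReal.ofReal_lt_top (energyBound_ne_top hp.le hGtop).lt_top)⟩
  simpa using h.add hup

/-- Rounding `η / ε` up overshoots `η` by less than `ε < η`. -/
theorem exists_nat_mul_mem_Icc {η ε : ℝ} (hη : 0 < η) (hε : 0 < ε) (h : ε < η) :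
    ∃ n : ℕ, 0 < n ∧ η ≤ n * ε ∧ n * ε ≤ 2 * η := by
  refine ⟨⌈η / ε⌉₊, Nat.ceil_pos.2 (by positivity), ?_, ?_⟩
  · exact (div_le_iff₀ hε).1 (Nat.le_ceil _)
  · have h1 := Nat.ceil_lt_add_one (a := η / ε) (by positivity)
    have h2 := mul_lt_mul_of_pos_right h1 hε
    rw [add_mul, div_mul_cancel₀ _ hε.ne'] at h2
    linarith

theorem totallyBounded_range_restrict {p r : ℝ} (hp : 1 < p) (hr : 0 < r)
    [Fact (1 ≤ ENNReal.ofReal p)]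
    (u : ℕ → Lp (EuclideanSpace ℝ (Fin m)) (ENNReal.ofReal p)
      (volume : Measure (EuclideanSpace ℝ (Fin d))))
    {ε : ℕ → ℝ} (hε : ∀ j, 0 < ε j) (hε0 : Tendsto ε atTop (𝓝 0))
    (hb : ∀ R : ℝ, ∃ A : ℝ, 0 ≤ A ∧
      ∀ j, ∫⁻ y in Metric.closedBall 0 R, ‖u j y‖ₑ ≤ ENNReal.ofReal A)
    {G : ℝ≥0∞} (hGtop : G ≠ ⊤) (hG : ∀ j, convEnergy r p (ε j) (u j) Set.univ ≤ G)
    (K : TopologicalSpace.Compacts (EuclideanSpace ℝ (Fin d))) :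
    TotallyBounded (Set.range fun j => LpLoc.restrict K (LpLoc.ofLp (u j))) := by
  obtain ⟨ρ, C, hC0, hρ, hρc, hsupp, hint, hC, hC'⟩ := exists_mollifier d hr
  have hsupp' : Function.support ρ ⊆ Metric.ball 0 r := (subset_tsupport ρ).trans hsupp
  have hum : ∀ j, StronglyMeasurable (u j) := fun j => Lp.stronglyMeasurable _
  have hul : ∀ j, LocallyIntegrable (u j) volume := fun j =>
    (Lp.memLp (u j)).locallyIntegrable Fact.out
  refine totallyBounded_of_forall_exists_dist_le fun δ hδ => ?_
  set D := energyBound d r p G with hD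
  have hDtop : D ≠ ⊤ := energyBound_ne_top hp.le hGtop
  -- Scales up to `2 * η` then give a mollification error of at most `2 * η * C * D ≤ δ`; the `+ 1`
  -- avoids dividing by zero.
  set η : ℝ := δ / (2 * C * (D.toReal + 1)) with hη
  have hη0 : 0 < η := by positivity
  obtain ⟨N, hN⟩ := eventually_atTop.1 (hε0.eventually (gt_mem_nhds hη0))
  have hn : ∀ j : Set.Ici N, ∃ n : ℕ, 0 < n ∧ η ≤ n * ε j ∧ n * ε j ≤ 2 * η := fun j =>
    exists_nat_mul_mem_Icc hη0 (hε j) (hN j j.2)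
  choose n hn0 hn1 hn2 using hn
  have hs : ∀ j : Set.Ici N, 0 < n j * ε j := fun j => hη0.trans_le (hn1 j)
  have hGs : ∀ j : Set.Ici N, convEnergy r p (n j * ε j) (u j) Set.univ ≤ G := fun j =>
    (convEnergy_nat_mul_le hp.le (hε j) (hn0 j) (hum j)).trans (hG j)
  let w : Set.Ici N → EuclideanSpace ℝ (Fin d) → EuclideanSpace ℝ (Fin m) := fun j =>
    mollify ρ (n j * ε j) (u j)
  have hw : ∀ j, MemLp (w j) (ENNReal.ofReal p)
      (volume.restrict (K : Set (EuclideanSpace ℝ (Fin d)))) := fun j =>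
    (memLp_mollify hp (hs j) hρ hρc hint hsupp' hC (hum j) (Lp.memLp _) (hul j) (hGs j)
      hGtop).restrict _
  -- The finitely many indices below `N`, where `ε j` may exceed `η`, are kept as they are; the
  -- others are mollified at scale `n j * ε j ∈ [η, 2η]`.
  refine ⟨(fun j => LpLoc.restrict K (LpLoc.ofLp (u j))) '' Set.Iio N ∪
    Set.range fun j => (hw j).toLp, ?_, ?_⟩
  · refine TotallyBounded.union ((Set.finite_Iio N).image _).totallyBounded ?_
    obtain ⟨R, hR⟩ := K.isCompact.isBounded.subset_closedBall 0
    obtain ⟨A, hA0, hA⟩ := hb (R + 2 * η * r)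
    have hA' : ∀ j : Set.Ici N, ∫⁻ y in Metric.closedBall 0 (R + n j * ε j * r), ‖u j y‖ₑ ≤
        ENNReal.ofReal A := fun j => by
      refine (lintegral_mono_set (Metric.closedBall_subset_closedBall ?_)).trans (hA j)
      have := hn2 j
      gcongr
    have hinv : ∀ j : Set.Ici N, ((n j * ε j) ^ d)⁻¹ ≤ (η ^ d)⁻¹ := fun j => by
      have := hn1 j
      gcongr
    refine totallyBounded_range_Lp_of_lipschitz K.isCompact K.isCompact.measure_lt_top.ne (w := w)
      (B := C * ((η ^ d)⁻¹ * A)) (L := η⁻¹ * (C * ((η ^ d)⁻¹ * A))) (fun j x hx => ?_)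
      (fun j x hx y hy => ?_) (fun j => MemLp.coeFn_toLp _) K.isCompact.measurableSet
    · refine (norm_mollify_le_of_lintegral_le (hs j) (hum j) hC0.le hsupp' hC hA0 (hA' j)
        (by simpa using hR hx)).trans ?_
      have := hinv j
      gcongr
    · refine (norm_mollify_sub_le_of_lintegral_le (hs j) (hum j) (hul j) hC0.le hρ hρc hsupp hC' hA0
        (hA' j) (by simpa using hR hx) (by simpa using hR hy)).trans ?_
      have h1 := hinv j
      have h2 := hn1 j
      have h3 := hs j
      rw [dist_eq_norm]
      gcongr
  · rintro _ ⟨j, rfl⟩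
    rcases lt_or_ge j N with hj | hj
    · exact ⟨_, Or.inl ⟨j, hj, rfl⟩, by simp [hδ.le]⟩
    refine ⟨_, Or.inr ⟨⟨j, hj⟩, rfl⟩, ?_⟩
    have h1 := eLpNorm_mollify_sub_le hp (hs ⟨j, hj⟩) hρ.continuous hρc hint hsupp' hC (hum j)
      (hul j) (hGs ⟨j, hj⟩)
    have h2 : edist (LpLoc.restrict K (LpLoc.ofLp (u j))) (hw ⟨j, hj⟩).toLp ≤
        ENNReal.ofReal (n ⟨j, hj⟩ * ε j * C) * D := by
      rw [edist_comm, LpLoc.restrict, Lp.edist_toLp_toLp]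
      exact (eLpNorm_mono_measure _ Measure.restrict_le_self).trans h1
    rw [dist_edist]
    refine (ENNReal.toReal_mono (ENNReal.mul_ne_top ENNReal.ofReal_ne_top hDtop) h2).trans ?_
    rw [ENNReal.toReal_mul, ENNReal.toReal_ofReal (mul_pos (hs ⟨j, hj⟩) hC0).le]
    calc _ ≤ 2 * η * C * D.toReal := by
          have := hn2 ⟨j, hj⟩
          gcongr
      _ ≤ 2 * η * C * (D.toReal + 1) := by
          gcongr
          linarith
      _ = δ := by
          rw [hη]
          field_simp

end Compactness

/-! ### Duality pairing between `L^p` and the conjugate exponent. -/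

section Pairing

variable {α F : Type*} [MeasurableSpace α] {μ : Measure α} [NormedAddCommGroup F] [NormedSpace ℝ F]

theorem enorm_integral_smul_le_eLpNorm_mul {p q : ℝ≥0∞} [ENNReal.HolderConjugate q p] {ψ : α → ℝ}
    {f : α → F} (hψ : AEStronglyMeasurable ψ μ) (hf : AEStronglyMeasurable f μ) :
    ‖∫ x, ψ x • f x ∂μ‖ₑ ≤ eLpNorm ψ q μ * eLpNorm f p μ := by
  refine (enorm_integral_le_lintegral_enorm _).trans ?_
  rw [← eLpNorm_one_eq_lintegral_enorm]
  exact eLpNorm_smul_le_mul_eLpNorm (r := 1) hf hψ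

theorem integrable_smul_of_memLp {p q : ℝ≥0∞} [ENNReal.HolderConjugate q p] {ψ : α → ℝ}
    {f : α → F} (hψ : MemLp ψ q μ) (hf : MemLp f p μ) : Integrable (fun x => ψ x • f x) μ :=
  memLp_one_iff_integrable.1 (hf.smul hψ)

/-- Integration against a function of the dual exponent, as a continuous linear map on `L^p`. -/
noncomputable def integralSMulCLM {p q : ℝ≥0∞} [ENNReal.HolderConjugate q p] [Fact (1 ≤ p)]
    {ψ : α → ℝ} (hψ : MemLp ψ q μ) : Lp F p μ →L[ℝ] F :=
  LinearMap.mkContinuous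
    { toFun := fun f => ∫ x, ψ x • f x ∂μ
      map_add' := fun f g => by
        rw [← integral_add (integrable_smul_of_memLp hψ (Lp.memLp f))
          (integrable_smul_of_memLp hψ (Lp.memLp g))]
        refine integral_congr_ae ?_
        filter_upwards [Lp.coeFn_add f g] with x hx
        rw [hx, Pi.add_apply, smul_add]
      map_smul' := fun c f => by
        rw [RingHom.id_apply, ← integral_smul]
        refine integral_congr_ae ?_
        filter_upwards [Lp.coeFn_smul c f] with x hx
        rw [hx, Pi.smul_apply, smul_comm] }
    (eLpNorm ψ q μ).toReal fun f => by
      have h := enorm_integral_smul_le_eLpNorm_mul (p := p) (q := q) hψ.1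
        (Lp.aestronglyMeasurable f)
      have h2 := ENNReal.toReal_mono (ENNReal.mul_ne_top hψ.2.ne (Lp.eLpNorm_ne_top f)) h
      rwa [toReal_enorm, ENNReal.toReal_mul] at h2

theorem integralSMulCLM_apply {p q : ℝ≥0∞} [ENNReal.HolderConjugate q p] [Fact (1 ≤ p)]
    {ψ : α → ℝ} (hψ : MemLp ψ q μ) (f : Lp F p μ) :
    integralSMulCLM hψ f = ∫ x, ψ x • f x ∂μ := rfl

theorem tendsto_integral_smul_of_tendsto_eLpNorm {E : Type*} [TopologicalSpace E]
    [MeasurableSpace E] {μ : Measure E} {p q : ℝ≥0∞} [ENNReal.HolderConjugate q p]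
    {ψ : E → ℝ} (hψ : MemLp ψ q μ)
    {w : ℕ → E → F} {v : E → F} (hw : ∀ n, MemLp (w n) p (μ.restrict (tsupport ψ)))
    (hv : MemLp v p (μ.restrict (tsupport ψ)))
    (h : Tendsto (fun n => eLpNorm (w n - v) p (μ.restrict (tsupport ψ))) atTop (𝓝 0)) :
    Tendsto (fun n => ∫ x, ψ x • w n x ∂μ) atTop (𝓝 (∫ x, ψ x • v x ∂μ)) := by
  have hψK : MemLp ψ q (μ.restrict (tsupport ψ)) := hψ.restrict _
  have e : ∀ f : E → F, ∫ x, ψ x • f x ∂μ = ∫ x in tsupport ψ, ψ x • f x ∂μ := fun f =>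
    (setIntegral_eq_integral_of_forall_compl_eq_zero fun x hx => by
      rw [image_eq_zero_of_notMem_tsupport hx, zero_smul]).symm
  rw [tendsto_iff_edist_tendsto_0]
  have h2 := ENNReal.Tendsto.const_mul (a := eLpNorm ψ q (μ.restrict (tsupport ψ))) h
    (Or.inr hψK.2.ne)
  rw [mul_zero] at h2
  refine tendsto_of_tendsto_of_tendsto_of_le_of_le tendsto_const_nhds h2 (fun _ => zero_le)
    fun n => ?_
  simp only [e]
  rw [edist_eq_enorm_sub, ← integral_sub (integrable_smul_of_memLp hψK (hw n))
    (integrable_smul_of_memLp hψK hv)]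
  simp only [← smul_sub]
  exact enorm_integral_smul_le_eLpNorm_mul (f := w n - v) hψK.1 ((hw n).1.sub hv.1)

end Pairing

/-! ### Sobolev regularity of the limits. -/

section Limits

theorem eLpNorm_le_of_forall_closedBall {E F : Type*} [NormedAddCommGroup E] [MeasurableSpace E]
    [OpensMeasurableSpace E] [NormedAddCommGroup F] {μ : Measure E} {p : ℝ≥0∞} {f : E → F}
    (hf : AEStronglyMeasurable f μ) {M : ℝ≥0∞}
    (h : ∀ n : ℕ, eLpNorm f p (μ.restrict (Metric.closedBall 0 n)) ≤ M) : eLpNorm f p μ ≤ M := by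
  refine Lp.eLpNorm_le_of_ae_tendsto (u := atTop)
    (f := fun n : ℕ => (Metric.closedBall (0 : E) n).indicator f) (Eventually.of_forall fun n => ?_)
    (fun n => hf.indicator Metric.isClosed_closedBall.measurableSet)
    (Eventually.of_forall fun x => ?_)
  · rw [eLpNorm_indicator_eq_eLpNorm_restrict Metric.isClosed_closedBall.measurableSet]
    exact h n
  · refine tendsto_const_nhds.congr' ?_
    filter_upwards [eventually_ge_atTop ⌈‖x‖⌉₊] with n hn
    rw [Set.indicator_of_mem]
    simpa using (Nat.le_ceil ‖x‖).trans (Nat.cast_le.2 hn)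

variable {d m : ℕ} {p : ℝ}

/-- A limit in `L^p_loc` of `C^1` functions in `L^p(ℝ^d)`, with gradients bounded in `L^p(ℝ^d)` is in
`W^{1,p}_loc`. -/
theorem memW1pLoc_of_tendsto (hp : 1 < p) [Fact (1 ≤ ENNReal.ofReal p)]
    {w : ℕ → EuclideanSpace ℝ (Fin d) → EuclideanSpace ℝ (Fin m)}
    {v : EuclideanSpace ℝ (Fin d) → EuclideanSpace ℝ (Fin m)} (hw : ∀ n, ContDiff ℝ 1 (w n))
    (hwp : ∀ n, MemLp (w n) (ENNReal.ofReal p) volume) {M : ℝ≥0∞} (hM : M ≠ ⊤)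
    (hwM : ∀ n, eLpNorm (fderiv ℝ (w n)) (ENNReal.ofReal p) volume ≤ M)
    (hv : MemLpLoc v (ENNReal.ofReal p))
    (h : ∀ K : Set (EuclideanSpace ℝ (Fin d)), IsCompact K →
      Tendsto (fun n => eLpNorm (w n - v) (ENNReal.ofReal p) (volume.restrict K)) atTop (𝓝 0)) :
    MemW1pLoc v (ENNReal.ofReal p) := by
  refine ⟨hv, fun i => ?_⟩
  set e : EuclideanSpace ℝ (Fin d) := EuclideanSpace.single i 1 with he
  have hec : ∀ n, Continuous fun x => fderiv ℝ (w n) x e := fun n =>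
    ((hw n).continuous_fderiv one_ne_zero).clm_apply continuous_const
  have hle : ∀ n, eLpNorm (fun x => fderiv ℝ (w n) x e) (ENNReal.ofReal p) volume ≤ M := fun n => by
    refine (eLpNorm_mono fun x => ?_).trans (hwM n)
    exact (ContinuousLinearMap.le_opNorm _ _).trans (by simp [he])
  have hmem : ∀ n, MemLp (fun x => fderiv ℝ (w n) x e) (ENNReal.ofReal p) volume := fun n =>
    ⟨(hec n).aestronglyMeasurable, (hle n).trans_lt hM.lt_top⟩
  -- `g` replaces a weak limit of the partial derivatives: it takes the right value under any
  -- continuous functional that converges along them.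
  obtain ⟨g, hg⟩ := Lp_exists_forall_apply_eq_of_tendsto hp (fun n => (hmem n).toLp)
    (R := M.toReal) fun n => by
      rw [Lp.norm_toLp]
      exact ENNReal.toReal_mono hM (hle n)
  refine ⟨g, fun K _ => (Lp.memLp g).restrict K, fun φ hφ hφc => ?_⟩
  have hconj : ENNReal.HolderConjugate (ENNReal.ofReal p.conjExponent) (ENNReal.ofReal p) :=
    (Real.HolderConjugate.conjExponent hp).symm.ennrealOfReal
  have hφ1 : ContDiff ℝ 1 φ := hφ.of_le (by norm_cast)
  have hdφ : Continuous fun x => fderiv ℝ φ x e :=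
    (hφ1.continuous_fderiv one_ne_zero).clm_apply continuous_const
  have hdφc : HasCompactSupport fun x => fderiv ℝ φ x e := hφc.fderiv_apply ℝ e
  have hφq : MemLp φ (ENNReal.ofReal p.conjExponent) volume :=
    hφ1.continuous.memLp_of_hasCompactSupport hφc
  have hdφq : MemLp (fun x => fderiv ℝ φ x e) (ENNReal.ofReal p.conjExponent) volume :=
    hdφ.memLp_of_hasCompactSupport hdφc
  have hlim := tendsto_integral_smul_of_tendsto_eLpNorm hdφq
    (fun n => (hwp n).restrict _) (hv _ hdφc) (h _ hdφc)
  have hparts : ∀ n, ∫ x, φ x • fderiv ℝ (w n) x e = -∫ x, fderiv ℝ φ x e • w n x := fun n =>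
    integral_smul_fderiv_eq_neg_fderiv_smul_of_integrable
      ((hdφ.smul (hw n).continuous).integrable_of_hasCompactSupport hdφc.smul_right)
      ((hφ1.continuous.smul (hec n)).integrable_of_hasCompactSupport hφc.smul_right)
      ((hφ1.continuous.smul (hw n).continuous).integrable_of_hasCompactSupport hφc.smul_right)
      (fun x _ => hφ1.differentiable one_ne_zero x)
      (fun x _ => (hw n).differentiable one_ne_zero x)
  -- Pairing with `φ` does converge along the derivatives: integration by parts moves the derivative
  -- onto `φ`, and `w n → v` on the support.
  have h1 := hg (integralSMulCLM hφq) (-∫ x, fderiv ℝ φ x e • v x) (by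
    refine hlim.neg.congr fun n => ?_
    rw [integralSMulCLM_apply, ← hparts]
    refine integral_congr_ae ?_
    filter_upwards [(hmem n).coeFn_toLp] with x hx
    rw [hx])
  rw [integralSMulCLM_apply] at h1
  rw [h1, neg_neg]

/-- A limit in `L^p_loc` of `C^1` functions in `L^p(ℝ^d)`, with gradients bounded in `L^p(ℝ^d)`, is
in `L^{p^*}(ℝ^d)`. -/
theorem memLp_sobolev_of_tendsto (hp : 1 < p) (hpd : p < d)
    {w : ℕ → EuclideanSpace ℝ (Fin d) → EuclideanSpace ℝ (Fin m)}
    {v : EuclideanSpace ℝ (Fin d) → EuclideanSpace ℝ (Fin m)} (hw : ∀ n, ContDiff ℝ 1 (w n))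
    (hwp : ∀ n, MemLp (w n) (ENNReal.ofReal p) volume) {M : ℝ≥0∞} (hM : M ≠ ⊤)
    (hwM : ∀ n, eLpNorm (fderiv ℝ (w n)) (ENNReal.ofReal p) volume ≤ M)
    (hv : AEStronglyMeasurable v volume)
    (h : ∀ K : Set (EuclideanSpace ℝ (Fin d)), IsCompact K →
      Tendsto (fun n => eLpNorm (w n - v) (ENNReal.ofReal p) (volume.restrict K)) atTop (𝓝 0)) :
    MemLp v (ENNReal.ofReal (p * d / (d - p))) volume := by
  refine ⟨hv, (eLpNorm_le_of_forall_closedBall hv fun n => ?_).trans_lt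
    (ENNReal.mul_lt_top (ENNReal.coe_lt_top (r := eLpNormLESNormFDerivOfEqInnerConst
        (volume : Measure (EuclideanSpace ℝ (Fin d))) p.toNNReal)) hM.lt_top)⟩
  have hmeas : ∀ j, AEStronglyMeasurable (w j) (volume.restrict (Metric.closedBall 0 (n : ℝ))) :=
    fun j => (hw j).continuous.aestronglyMeasurable
  -- Convergence in `L^p` of the ball gives convergence in measure, under which the `L^{p^*}` norm
  -- is lower semicontinuous.
  refine eLpNorm_le_of_tendstoInMeasure (u := atTop) (f := w) (Eventually.of_forall fun j => ?_)
    (tendstoInMeasure_of_tendsto_eLpNorm (p := ENNReal.ofReal p) (by simp; linarith) hmeas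
      hv.restrict (h _ (isCompact_closedBall _ _))) hmeas
  refine (eLpNorm_mono_measure _ Measure.restrict_le_self).trans ?_
  exact (eLpNorm_le_eLpNorm_fderiv_of_memLp hp.le hpd (hw j) (hwp j)).trans
    (mul_le_mul_right (hwM j) _)

/-- Here the mollification scale is `ε j` itself: the error is `O(ε j)`, so the mollified functions
have the same limit, while their gradients stay bounded in `L^p`. -/
theorem sobolev_of_tendsto_of_convEnergy_le {r : ℝ} (hp : 1 < p) (hpd : p < d) (hr : 0 < r)
    [Fact (1 ≤ ENNReal.ofReal p)]
    (u : ℕ → Lp (EuclideanSpace ℝ (Fin m)) (ENNReal.ofReal p)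
      (volume : Measure (EuclideanSpace ℝ (Fin d))))
    {ε : ℕ → ℝ} (hε : ∀ j, 0 < ε j) (hε0 : Tendsto ε atTop (𝓝 0))
    {G : ℝ≥0∞} (hGtop : G ≠ ⊤) (hG : ∀ j, convEnergy r p (ε j) (u j) Set.univ ≤ G)
    {v : LpLoc d m (ENNReal.ofReal p)}
    (hv : Tendsto (fun j => LpLoc.ofLp (u j)) atTop (𝓝 v)) :
    MemW1pLoc v.1 (ENNReal.ofReal p) ∧ MemLp v.1 (ENNReal.ofReal (p * d / (d - p))) volume := by
  obtain ⟨ρ, C, hC0, hρ, hρc, hsupp, hint, hC, hC'⟩ := exists_mollifier d hr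
  have hsupp' : Function.support ρ ⊆ Metric.ball 0 r := (subset_tsupport ρ).trans hsupp
  have hum : ∀ j, StronglyMeasurable (u j) := fun j => Lp.stronglyMeasurable _
  have hul : ∀ j, LocallyIntegrable (u j) volume := fun j =>
    (Lp.memLp (u j)).locallyIntegrable Fact.out
  have hDtop : energyBound d r p G ≠ ⊤ := energyBound_ne_top hp.le hGtop
  have hM : ENNReal.ofReal C * energyBound d r p G ≠ ⊤ :=
    ENNReal.mul_ne_top ENNReal.ofReal_ne_top hDtop
  have hw : ∀ j, ContDiff ℝ 1 (mollify ρ (ε j) (u j)) := fun j =>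
    contDiff_mollify (hε j) hρ hρc (hul j)
  have hwp : ∀ j, MemLp (mollify ρ (ε j) (u j)) (ENNReal.ofReal p) volume := fun j =>
    memLp_mollify hp (hε j) hρ hρc hint hsupp' hC (hum j) (Lp.memLp _) (hul j) (hG j) hGtop
  have hwM : ∀ j, eLpNorm (fderiv ℝ (mollify ρ (ε j) (u j))) (ENNReal.ofReal p) volume ≤
      ENNReal.ofReal C * energyBound d r p G := fun j =>
    eLpNorm_fderiv_mollify_le hp (hε j) hC0 hρ hρc hsupp hC' (hum j) (hul j) (hG j)
  have hlim : ∀ K : Set (EuclideanSpace ℝ (Fin d)), IsCompact K →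
      Tendsto (fun j => eLpNorm (mollify ρ (ε j) (u j) - ⇑v.1) (ENNReal.ofReal p)
        (volume.restrict K)) atTop (𝓝 0) := fun K hK => by
    have h1 : Tendsto (fun j => ENNReal.ofReal (ε j * C) * energyBound d r p G) atTop (𝓝 0) := by
      have h2 := ENNReal.tendsto_ofReal (hε0.mul_const C)
      rw [zero_mul, ENNReal.ofReal_zero] at h2
      simpa using ENNReal.Tendsto.mul_const h2 (Or.inr hDtop)
    have h2 := tendsto_iff_edist_tendsto_0.1 (LpLoc.tendsto_iff.1 hv ⟨K, hK⟩)
    have h3 := h1.add h2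
    rw [add_zero] at h3
    refine tendsto_of_tendsto_of_tendsto_of_le_of_le tendsto_const_nhds h3 (fun _ => zero_le)
      fun j => ?_
    have e : mollify ρ (ε j) (u j) - ⇑v.1 = (mollify ρ (ε j) (u j) - u j) + (⇑(u j) - ⇑v.1) := by
      rw [sub_add_sub_cancel]
    rw [e]
    refine (eLpNorm_add_le ((hwp j).1.sub (Lp.memLp (u j)).1).restrict
      ((Lp.memLp (u j)).1.sub v.1.aestronglyMeasurable).restrict Fact.out).trans
      (add_le_add ?_ (le_of_eq ?_))
    · exact (eLpNorm_mono_measure _ Measure.restrict_le_self).trans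
        (eLpNorm_mollify_sub_le hp (hε j) hρ.continuous hρc hint hsupp' hC (hum j) (hul j) (hG j))
    · exact (Lp.edist_toLp_toLp _ _ ((LpLoc.ofLp (u j)).2 K hK) (v.2 K hK)).symm
  exact ⟨memW1pLoc_of_tendsto hp hw hwp hM hwM v.2 hlim,
    memLp_sobolev_of_tendsto hp hpd hw hwp hM hwM v.1.aestronglyMeasurable hlim⟩

/-- Hölder's inequality on the ball; it supplies the local `L^1` bounds behind the equi-Lipschitz
estimate. -/
theorem exists_lintegral_closedBall_le {F ι : Type*} [NormedAddCommGroup F] {p : ℝ≥0∞} (hp : 1 ≤ p)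
    {u : ι → EuclideanSpace ℝ (Fin d) → F} (hu : ∀ i, AEStronglyMeasurable (u i) volume) (R : ℝ)
    (h : (⨆ i, eLpNorm (u i) p (volume.restrict (Metric.closedBall 0 R))) < ⊤) :
    ∃ A : ℝ, 0 ≤ A ∧ ∀ i, ∫⁻ y in Metric.closedBall 0 R, ‖u i y‖ₑ ≤ ENNReal.ofReal A := by
  set V := (volume (Metric.closedBall (0 : EuclideanSpace ℝ (Fin d)) R)) ^ (1 - 1 / p.toReal)
    with hV
  have hVtop : V ≠ ⊤ := by
    refine ENNReal.rpow_ne_top_of_nonneg ?_ measure_closedBall_lt_top.ne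
    rcases eq_or_ne p ⊤ with rfl | hpt
    · simp
    · have : 1 ≤ p.toReal := by simpa using ENNReal.toReal_mono hpt hp
      rw [sub_nonneg]
      exact div_le_one_of_le₀ this (by positivity)
  refine ⟨((⨆ i, eLpNorm (u i) p (volume.restrict (Metric.closedBall 0 R))) * V).toReal,
    ENNReal.toReal_nonneg, fun i => ?_⟩
  rw [ENNReal.ofReal_toReal (ENNReal.mul_ne_top h.ne hVtop), ← eLpNorm_one_eq_lintegral_enorm]
  refine (eLpNorm_le_eLpNorm_mul_rpow_measure_univ hp (hu i).restrict).trans ?_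
  rw [Measure.restrict_apply_univ, ENNReal.toReal_one, div_one]
  exact mul_le_mul_left (le_iSup (fun i => eLpNorm (u i) p
    (volume.restrict (Metric.closedBall 0 R))) i) _

end Limits

/-! ### The main theorem. -/

theorem mainTheorem5 (d m : ℕ) (p r : ℝ) (hp : 1 < p) (hpd : p < d) (hr : 0 < r)
    [Fact (1 ≤ ENNReal.ofReal p)]
    (u : ℝ → Lp (EuclideanSpace ℝ (Fin m)) (ENNReal.ofReal p)
      (volume : Measure (EuclideanSpace ℝ (Fin d))))
    (hbound : ∀ K : Set (EuclideanSpace ℝ (Fin d)), IsCompact K →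
      (⨆ ε : Set.Ioi (0 : ℝ),
        eLpNorm (u ε) (ENNReal.ofReal p) (volume.restrict K)) < ⊤)
    (henergy : (⨆ ε : Set.Ioi (0 : ℝ), convEnergy r p ε (u ε) Set.univ) < ⊤) :
    ∀ ε : ℕ → ℝ, (∀ j, 0 < ε j) → Tendsto ε atTop (𝓝 0) →
      IsCompact (closure (Set.range fun j => LpLoc.ofLp (u (ε j)))) ∧
      ∀ (k : ℕ → ℕ) (v : LpLoc d m (ENNReal.ofReal p)), StrictMono k →
        Tendsto (fun j => LpLoc.ofLp (u (ε (k j)))) atTop (𝓝 v) →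
          MemW1pLoc v.1 (ENNReal.ofReal p) ∧
          MemLp v.1 (ENNReal.ofReal (p * d / (d - p))) volume := by
  intro ε hε hε0
  have hG : ∀ j, convEnergy r p (ε j) (u (ε j)) Set.univ ≤
      ⨆ ε : Set.Ioi (0 : ℝ), convEnergy r p ε (u ε) Set.univ := fun j =>
    le_iSup (fun ε : Set.Ioi (0 : ℝ) => convEnergy r p ε (u ε) Set.univ) ⟨ε j, hε j⟩
  refine ⟨LpLoc.isCompact_closure fun K => ?_, fun k v hk hv => ?_⟩
  · rw [← Set.range_comp]
    refine totallyBounded_range_restrict hp hr (fun j => u (ε j)) hε hε0 (fun R => ?_)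
      henergy.ne hG K
    obtain ⟨A, hA0, hA⟩ := exists_lintegral_closedBall_le (p := ENNReal.ofReal p) Fact.out
      (u := fun ε : Set.Ioi (0 : ℝ) => u ε) (fun ε => Lp.aestronglyMeasurable _) R
      (hbound _ (isCompact_closedBall _ _))
    exact ⟨A, hA0, fun j => hA ⟨ε j, hε j⟩⟩
  · exact sobolev_of_tendsto_of_convEnergy_le hp hpd hr (fun j => u (ε (k j))) (fun j => hε (k j))
      (hε0.comp hk.tendsto_atTop) henergy.ne (fun j => hG (k j)) hv
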